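/- Let $V$ be an $n$-dimensional real affine space. A polytope $P\subset V$ is a compact set with non-empty interior that is a finite intersection of half spaces; it is simple if every vertex lies in precisely $n$ facets. A flat measure on a polytope or on one of its faces is the restriction of a translation invariant measure on its affine span that is finite on compact sets and positive on non-empty open sets. A flat measure on $\partial P$ is a measure on $\partial P$ whose restriction to each facet is flat. A system $\mathcal P=(P,d\mu,d\sigma)$ consists of a simple polytope $P$, a flat measure $d\mu$ on $P$ and a flat measure $d\sigma$ on $\partial P$. A state is a lower semi-continuous log convex function $u:P\to(0,\infty]$ with $\int_P u\,d\mu=\int_P d\mu$. For a state $u$ put $$S(u)=-\frac{1}{\int_P d\mu}\int_P u\log u\,d\mu\in[-\infty,0],\qquad U(u)=\frac{1}{\int_P d\mu}\int_{\partial P}u\,d\sigma\in[0,\infty],$$ and, for $T\in\mathbb R$, $F(T,u)=U(u)-T\,S(u)$ if $S(u)>-\infty$ and $F(T,u)=\infty$ if $S(u)=-\infty$. For $T>0$ the canonical distribution $u_T^{\mathrm{can}}$ is the minimizer of $F(T,\cdot)$ on the set of states; for $T=0$ it is the minimizer of $F(0,\cdot)$ that has the largest entropy $S$ among all minimizers of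 $F(0,\cdot)$. The system is K-unstable if $$\mathrm{DF}(q)=\frac{2\pi}{\int_P d\mu}\Big(\int_{\partial P}q\,d\sigma-\frac{\int_{\partial P}d\sigma}{\int_P d\mu}\int_P q\,d\mu\Big)<0$$ for some convex function $q:P\to(-\infty,\infty]$ that is integrable on $P$ and on $\partial P$. Let $\mathfrak U^*_{\mathcal P}=[\min U,\,U(1_P))$, where the minimum is over all states and $1_P$ is the constant state $1$. For $U\in\mathbb R$ let $$\mathbb T^{\mathrm{can}}_{\mathcal P}(U)=\{T\in[0,\infty)\mid U(u_T^{\mathrm{can}})=U\},\qquad S^{\mathrm{eq}}_{\mathcal P}(U)=\sup\{S(u)\mid u \text{ a state},\ U(u)=U\},$$ with $\sup\emptyset=-\infty$. **Proposition.** Let $\mathcal P$ be a K-unstable system and let $U\in\mathfrak U^*_{\mathcal P}$. Then the right and left derivatives $\beta^{+}$ and $\beta^{-}$ of $S^{\mathrm{eq}}_{\mathcal P}$ at $U$ exist in $(0,\infty]$, and $$\mathbb T^{\mathrm{can}}_{\mathcal P}(U)=\Big[\frac1{\beta^{-}},\frac1{\beta^{+}}\Big]=:\mathbb T^{\mathrm{eq}}_{\mathcal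 P}(U),$$ where $1/\infty=0$. -/

import Mathlib

open MeasureTheory Set Filter Topology
open scoped ENNReal

namespace NAThermo

section Polytopes

variable {V : Type*} [NormedAddCommGroup V] [NormedSpace ℝ V]

/-- A polytope: a compact set with non-empty interior that is the intersection of finitely many
half spaces `ℓ ⁻¹' [0, ∞)`, with `ℓ` a non-constant affine function. -/
def IsPolytope (P : Set V) : Prop :=
  IsCompact P ∧ (interior P).Nonempty ∧
    ∃ s : Finset (V →ᵃ[ℝ] ℝ), (∀ l ∈ s, l.linear ≠ 0) ∧ P = {x | ∀ l ∈ s, 0 ≤ l x}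

/-- `F` is a face of `P`: the intersection of `P` with the bounding hyperplane of a half space
that contains `P`. -/
def IsFaceOf (F P : Set V) : Prop :=
  ∃ l : V →ᵃ[ℝ] ℝ, l.linear ≠ 0 ∧ (∀ x ∈ P, 0 ≤ l x) ∧ F = P ∩ {x | l x = 0}

/-- A facet is a non-empty face whose affine span has codimension one. -/
def IsFacetOf (F P : Set V) : Prop :=
  IsFaceOf F P ∧ F.Nonempty ∧
    Module.finrank ℝ (affineSpan ℝ F).direction + 1 = Module.finrank ℝ V

/-- A simple polytope: every vertex (one-point face) lies in precisely `dim V` facets. -/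
def IsSimplePolytope (P : Set V) : Prop :=
  IsPolytope P ∧
    ∀ v : V, IsFaceOf {v} P → {F : Set V | IsFacetOf F P ∧ v ∈ F}.ncard = Module.finrank ℝ V

variable [MeasurableSpace V]

/-- `m` is a flat measure on `F`: the restriction to `F` of a measure on the affine span of `F`
which is invariant under the translations of that affine subspace, finite on compact sets and
positive on its non-empty open subsets. The affine span is parametrised by its direction,
through a base point of `F`. -/
def IsFlatOn (m : Measure V) (F : Set V) : Prop :=
  ∃ x ∈ F, ∃ ν : Measure (affineSpan ℝ F).direction, ν.IsAddHaarMeasure ∧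
    m = (ν.map (fun v : (affineSpan ℝ F).direction => x + (v : V))).restrict F

end Polytopes

/-- A system `(P, dμ, dσ)`: a simple polytope, a flat measure on `P`, and a flat measure on the
boundary of `P`, i.e. one whose restriction to each facet is flat. Both measures are recorded as
measures on the ambient space that are carried by `P`, respectively by `∂P`. -/
structure System (V : Type*) [NormedAddCommGroup V] [NormedSpace ℝ V] [MeasurableSpace V] where
  P : Set V
  simple : IsSimplePolytope P
  μ : Measure V
  μ_flat : ∃ ν : Measure V, ν.IsAddHaarMeasure ∧ μ = ν.restrict P
  σ : Measure V
  σ_carried : σ (frontier P)ᶜ = 0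
  σ_flat : ∀ F : Set V, IsFacetOf F P → IsFlatOn (σ.restrict F) F

namespace System

noncomputable section

variable {V : Type*} [NormedAddCommGroup V] [NormedSpace ℝ V] [MeasurableSpace V]
  (sys : System V)

/-- The states: lower semi-continuous log convex `u : P → (0, ∞]` with `∫ u dμ = ∫ dμ`.
Only the values of `u` on `P` matter. -/
def IsState (u : V → ℝ≥0∞) : Prop :=
  (∀ x ∈ sys.P, 0 < u x) ∧ LowerSemicontinuousOn u sys.P ∧
    (∀ x ∈ sys.P, ∀ y ∈ sys.P, ∀ t : ℝ, 0 ≤ t → t ≤ 1 →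
      u ((1 - t) • x + t • y) ≤ u x ^ (1 - t) * u y ^ t) ∧
    ∫⁻ x, u x ∂sys.μ = sys.μ univ

open scoped Classical in
/-- The entropy `S(u) = - (∫ dμ)⁻¹ ∫ u log u dμ ∈ [-∞, 0]`. A state is finite a.e. and
`u log u` is bounded below, so that its integral is `+∞` when it is not integrable. -/
def entropy (u : V → ℝ≥0∞) : EReal :=
  if Integrable (fun x => (u x).toReal * Real.log (u x).toReal) sys.μ then
    ((-((∫ x, (u x).toReal * Real.log (u x).toReal ∂sys.μ) / sys.μ.real univ) : ℝ) : EReal)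
  else ⊥

/-- The internal energy `U(u) = (∫ dμ)⁻¹ ∫_{∂P} u dσ ∈ [0, ∞]`. -/
def energy (u : V → ℝ≥0∞) : EReal :=
  (((∫⁻ x, u x ∂sys.σ) / sys.μ univ : ℝ≥0∞) : EReal)

open scoped Classical in
/-- The free energy `F(T, u) = U(u) - T S(u)`, with value `∞` where `S(u) = -∞`. -/
def freeEnergy (T : ℝ) (u : V → ℝ≥0∞) : EReal :=
  if sys.entropy u = ⊥ then ⊤ else sys.energy u - (T : EReal) * sys.entropy u

/-- `u` minimizes `F(T, ·)` on the states. -/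
def IsMinimizer (T : ℝ) (u : V → ℝ≥0∞) : Prop :=
  sys.IsState u ∧ ∀ v, sys.IsState v → sys.freeEnergy T u ≤ sys.freeEnergy T v

/-- `u` is the canonical distribution of temperature `T`: it minimizes `F(T, ·)`, and for `T = 0`
it has the largest entropy among all minimizers. -/
def IsCanonical (T : ℝ) (u : V → ℝ≥0∞) : Prop :=
  sys.IsMinimizer T u ∧
    (T = 0 → ∀ v, sys.IsMinimizer 0 v → sys.entropy v ≤ sys.entropy u)

/-- `𝕋^can(U)`: the temperatures whose canonical distribution has internal energy `U`. -/
def canTemp (U : ℝ) : Set ℝ :=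
  {T | 0 ≤ T ∧ ∃ u, sys.IsCanonical T u ∧ sys.energy u = (U : EReal)}

/-- `𝔘* = [min U, U(1_P))`. -/
def energyRange : Set ℝ :=
  {U | (⨅ (u : V → ℝ≥0∞) (_ : sys.IsState u), sys.energy u) ≤ (U : EReal) ∧
    (U : EReal) < sys.energy (fun _ => 1)}

/-- The equilibrium entropy: the supremum of the entropy over the states of internal energy `U`
(`-∞` if there are none). -/
def eqEntropy (U : ℝ) : EReal :=
  ⨆ (u : V → ℝ≥0∞) (_ : sys.IsState u ∧ sys.energy u = (U : EReal)), sys.entropy u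

/-- Convex functions `q : P → (-∞, ∞]` that are integrable on `P` and on `∂P`. -/
def IsIntegrableConvex (q : V → EReal) : Prop :=
  (∀ x ∈ sys.P, q x ≠ ⊥) ∧
    (∀ x ∈ sys.P, ∀ y ∈ sys.P, ∀ t : ℝ, 0 < t → t < 1 →
      q ((1 - t) • x + t • y) ≤ ((1 - t : ℝ) : EReal) * q x + (t : EReal) * q y) ∧
    (∀ᵐ x ∂sys.μ, q x ≠ ⊤) ∧ Integrable (fun x => (q x).toReal) sys.μ ∧
    (∀ᵐ x ∂sys.σ, q x ≠ ⊤) ∧ Integrable (fun x => (q x).toReal) sys.σ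

/-- The Donaldson-Futaki invariant
`DF(q) = 2π (∫ dμ)⁻¹ (∫_{∂P} q dσ - (∫_{∂P} dσ / ∫ dμ) ∫ q dμ)`. -/
def DF (q : V → EReal) : ℝ :=
  2 * Real.pi / sys.μ.real univ *
    (∫ x, (q x).toReal ∂sys.σ -
      sys.σ.real univ / sys.μ.real univ * ∫ x, (q x).toReal ∂sys.μ)

/-- A system is K-unstable if `DF(q) < 0` for some convex function `q`. -/
def IsKUnstable : Prop :=
  ∃ q : V → EReal, sys.IsIntegrableConvex q ∧ sys.DF q < 0

end

end System

/-- `b` is the right derivative of `f` at `x`, in the extended reals. -/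
def HasRightDeriv (f : ℝ → EReal) (b : EReal) (x : ℝ) : Prop :=
  Tendsto (fun y : ℝ => (f y - f x) / ((y - x : ℝ) : EReal)) (𝓝[>] x) (𝓝 b)

/-- `b` is the left derivative of `f` at `x`, in the extended reals. -/
def HasLeftDeriv (f : ℝ → EReal) (b : EReal) (x : ℝ) : Prop :=
  Tendsto (fun y : ℝ => (f y - f x) / ((y - x : ℝ) : EReal)) (𝓝[<] x) (𝓝 b)

end NAThermo

/-! Mixtures $(1-t)u+tv$ of states are states; the energy is affine and the entropy concave along
them, so `eqEntropy` is the upper envelope of a convex picture in the energy-entropy plane. The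
constant state has the largest entropy, $0$, and every state of entropy $0$ has at least its energy.
Hence below $U(1_P)$ the envelope is concave with positive one-sided slopes. For $T>0$ a state of
energy $U$ minimizes $U(u)-TS(u)$ exactly when it attains the envelope and the line of slope $1/T$
through its point lies above the envelope, that is, when $\beta^+\le 1/T\le\beta^-$. For $T=0$
minimizing means that $U$ is the least energy; this is the case $\beta^-=\infty$, because the
envelope is $-\infty$ further left. This convexity argument is `exists_derivs_of_ensemble`.

It needs the supremum to be attained, which is `exists_max_entropy`. Uniform convexity of $a\log a$
in terms of $\sqrt a$ makes the square roots of a maximizing sequence Cauchy in $L^2(\mu)$, so no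
mass is lost in the limit. Log convexity turns almost everywhere convergence into convergence inside
$P$ and yields a lower semi-continuous limit lying below the lower limits on $\partial P$; Fatou's
lemma then bounds its energy.

Entropies are finite at finite energy by `exists_negEntropy_le`: on the segment from an interior
point to $y\in\partial P$ a state is at most $Kb^r$ with $b=\max(1,u(y))$, and $\int_0^1 b^r\log
b\,dr=b-1$ is only linear in $b$. -/

namespace NAThermo

/-! ### Polytopes, facets and the cones over them. -/

section Geometry

variable {V : Type*} [NormedAddCommGroup V] [NormedSpace ℝ V]

/-- The cone over `F` with apex `x₀`: the union of the segments from `x₀` to points of `F`. -/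
def coneOver (x₀ : V) (F : Set V) : Set V :=
  (fun p : ℝ × V => AffineMap.lineMap x₀ p.2 p.1) '' (Icc (0 : ℝ) 1 ×ˢ F)

theorem isCompact_coneOver (x₀ : V) {F : Set V} (hF : IsCompact F) :
    IsCompact (coneOver x₀ F) := by
  refine (isCompact_Icc.prod hF).image ?_
  simp only [AffineMap.lineMap_apply_module]
  fun_prop

theorem IsPolytope.isClosed {P : Set V} (hP : IsPolytope P) : IsClosed P := hP.1.isClosed

theorem IsPolytope.convex {P : Set V} (hP : IsPolytope P) : Convex ℝ P := by
  obtain ⟨-, -, s, -, rfl⟩ := hP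
  have : {x : V | ∀ l ∈ s, 0 ≤ l x} = ⋂ l ∈ s, l ⁻¹' Ici 0 := by
    ext x; simp
  rw [this]
  exact convex_iInter₂ fun l _ => (convex_Ici (0 : ℝ)).affine_preimage l

/-- A non-constant affine function that is non-negative on `P` is positive inside `P`. -/
theorem affine_pos_of_mem_interior {P : Set V} {l : V →ᵃ[ℝ] ℝ} (hl : l.linear ≠ 0)
    (h : ∀ x ∈ P, 0 ≤ l x) {x : V} (hx : x ∈ interior P) : 0 < l x := by
  obtain ⟨v, hv⟩ : ∃ v, l.linear v ≠ 0 := by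
    by_contra! hc
    exact hl (LinearMap.ext hc)
  have hmem : ∀ᶠ e : ℝ in 𝓝 0, x + e • v ∈ P := by
    have hc : ContinuousAt (fun e : ℝ => x + e • v) 0 := by fun_prop
    apply hc.eventually
    simpa using mem_interior_iff_mem_nhds.1 hx
  obtain ⟨d, hd, hball⟩ := Metric.eventually_nhds_iff.1 hmem
  have key : ∀ e : ℝ, |e| < d → 0 ≤ e * l.linear v + l x := by
    intro e he
    have h1 := h _ (hball (y := e) (by simpa using he))
    have h2 : l (x + e • v) = e * l.linear v + l x := by
      have := l.map_vadd x (e • v)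
      rw [vadd_eq_add, add_comm] at this
      rw [this]; simp
    rwa [h2] at h1
  have hx0 : 0 ≤ l x := h x (interior_subset hx)
  rcases hx0.lt_or_eq with h0 | h0
  · exact h0
  · exfalso
    have h1 := key (d / 2) (by rw [abs_of_pos] <;> linarith)
    have h2 := key (-(d / 2)) (by rw [abs_neg, abs_of_pos] <;> linarith)
    rw [← h0] at h1 h2
    have h3 : d / 2 * l.linear v = 0 := by linarith
    rcases mul_eq_zero.1 h3 with h4 | h4
    · linarith
    · exact hv h4

theorem coneOver_subset_affineSpan (x₀ : V) (F : Set V) :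
    coneOver x₀ F ⊆ affineSpan ℝ (insert x₀ F) := by
  rintro _ ⟨⟨r, y⟩, ⟨-, hy⟩, rfl⟩
  exact AffineMap.lineMap_mem r (mem_affineSpan ℝ (mem_insert _ _))
    (mem_affineSpan ℝ (mem_insert_of_mem _ hy))

theorem direction_affineSpan_face_le_ker (P : Set V) (l : V →ᵃ[ℝ] ℝ) :
    (affineSpan ℝ (P ∩ {x | l x = 0})).direction ≤ LinearMap.ker l.linear := by
  rw [direction_affineSpan, vectorSpan_def, Submodule.span_le]
  rintro _ ⟨x, hx, y, hy, rfl⟩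
  have hx' : l x = 0 := hx.2
  have hy' : l y = 0 := hy.2
  simp only [SetLike.mem_coe, LinearMap.mem_ker]
  rw [AffineMap.linearMap_vsub, hx', hy', vsub_self]

variable [FiniteDimensional ℝ V]

theorem finrank_direction_affineSpan_face_lt {P : Set V} {l : V →ᵃ[ℝ] ℝ} (hl : l.linear ≠ 0) :
    Module.finrank ℝ (affineSpan ℝ (P ∩ {x | l x = 0})).direction < Module.finrank ℝ V := by
  refine (Submodule.finrank_mono (direction_affineSpan_face_le_ker P l)).trans_lt
    (Submodule.finrank_lt ?_)
  rwa [Ne, LinearMap.ker_eq_top]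

theorem mem_interior_of_forall_pos {s : Finset (V →ᵃ[ℝ] ℝ)} {x : V} (hx : ∀ l ∈ s, 0 < l x) :
    x ∈ interior {x : V | ∀ l ∈ s, 0 ≤ l x} := by
  rw [mem_interior_iff_mem_nhds]
  have : ∀ᶠ y in 𝓝 x, ∀ l ∈ s, 0 ≤ l y := by
    rw [Filter.eventually_all_finset]
    intro l hl
    filter_upwards [(l.continuous_of_finiteDimensional.tendsto x).eventually
      (lt_mem_nhds (hx l hl))] with y hy using hy.le
  exact this

/-- Each point of the polytope other than the interior point `x₀` lies on a segment from `x₀` to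
a point on one of the bounding hyperplanes. -/
theorem exists_mem_coneOver {s : Finset (V →ᵃ[ℝ] ℝ)}
    (hc : IsCompact {x : V | ∀ l ∈ s, 0 ≤ l x}) {x₀ z : V}
    (hz : z ∈ {x : V | ∀ l ∈ s, 0 ≤ l x}) (hne : z ≠ x₀) :
    ∃ l ∈ s, z ∈ coneOver x₀ ({x : V | ∀ l ∈ s, 0 ≤ l x} ∩ {x | l x = 0}) := by
  set P := {x : V | ∀ l ∈ s, 0 ≤ l x} with hP
  have hcont : Continuous fun r : ℝ => (AffineMap.lineMap x₀ z r : V) := by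
    simp only [AffineMap.lineMap_apply_module]; fun_prop
  -- Prolong the segment from `x₀` through `z` as far as `P` allows. At the last point some defining
  -- function vanishes, since otherwise one could go further.
  set R := {r : ℝ | 1 ≤ r ∧ (AffineMap.lineMap x₀ z r : V) ∈ P} with hR
  have hRc : IsClosed R := isClosed_Ici.inter (hc.isClosed.preimage hcont)
  obtain ⟨M, hM⟩ := hc.isBounded.subset_closedBall x₀
  have hpos : 0 < dist x₀ z := dist_pos.2 hne.symm
  have hRb : R ⊆ Icc 1 (M / dist x₀ z) := by
    rintro r ⟨h1, h2⟩
    refine ⟨h1, ?_⟩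
    have h3 := hM h2
    rw [Metric.mem_closedBall, dist_lineMap_left, Real.norm_of_nonneg (by linarith)] at h3
    rwa [le_div_iff₀ hpos]
  have hRcomp : IsCompact R := isCompact_Icc.of_isClosed_subset hRc hRb
  obtain ⟨r, hr, hmax⟩ := hRcomp.exists_isGreatest ⟨1, le_rfl, by simpa using hz⟩
  have hr0 : 0 < r := by linarith [hr.1]
  obtain ⟨l, hl, hly⟩ : ∃ l ∈ s, l (AffineMap.lineMap x₀ z r) = 0 := by
    by_contra! hcon
    have hin : (AffineMap.lineMap x₀ z r : V) ∈ interior P :=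
      mem_interior_of_forall_pos fun l hl => lt_of_le_of_ne (hr.2 l hl) (hcon l hl).symm
    have hev : ∀ᶠ t in 𝓝 r, (AffineMap.lineMap x₀ z t : V) ∈ P :=
      hcont.continuousAt.eventually (mem_interior_iff_mem_nhds.1 hin)
    obtain ⟨d, hd, hball⟩ := Metric.eventually_nhds_iff.1 hev
    have h1 : r + d / 2 ∈ R := by
      refine ⟨by linarith [hr.1], hball ?_⟩
      rw [Real.dist_eq, add_sub_cancel_left, abs_of_pos] <;> linarith
    linarith [hmax h1]
  refine ⟨l, hl, (r⁻¹, AffineMap.lineMap x₀ z r), ⟨⟨by positivity, inv_le_one_of_one_le₀ hr.1⟩,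
    hr.2, hly⟩, ?_⟩
  simp only [AffineMap.lineMap_apply, vsub_eq_sub, vadd_eq_add, add_sub_cancel_right, smul_smul,
    inv_mul_cancel₀ hr0.ne', one_smul, sub_add_cancel]

theorem exists_eq_zero_of_mem_frontier {s : Finset (V →ᵃ[ℝ] ℝ)} {y : V}
    (hy : y ∈ frontier {x : V | ∀ l ∈ s, 0 ≤ l x})
    (hcl : IsClosed {x : V | ∀ l ∈ s, 0 ≤ l x}) : ∃ l ∈ s, l y = 0 := by
  by_contra! hcon
  have hyP := hcl.frontier_subset hy
  exact hy.2 (mem_interior_of_forall_pos fun l hl => lt_of_le_of_ne (hyP l hl) (hcon l hl).symm)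

variable [MeasurableSpace V] [BorelSpace V]

/-- The cone over a set of affine codimension at least two is a null set. -/
theorem measure_coneOver_eq_zero (ν : Measure V) [ν.IsAddHaarMeasure] (x₀ : V) {F : Set V}
    (hF : Module.finrank ℝ (affineSpan ℝ F).direction + 1 < Module.finrank ℝ V) :
    ν (coneOver x₀ F) = 0 := by
  refine measure_mono_null (coneOver_subset_affineSpan x₀ F)
    (Measure.addHaar_affineSubspace ν _ fun htop => ?_)
  have h1 := finrank_vectorSpan_insert_le_set ℝ F x₀
  rw [← direction_affineSpan, htop, AffineSubspace.direction_top, finrank_top,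
    ← direction_affineSpan] at h1
  omega

/-- The facets of a polytope cover its boundary, and the cones over them with apex a given
interior point cover the polytope up to a null set. -/
theorem IsPolytope.exists_facets [Nontrivial V] (ν : Measure V) [ν.IsAddHaarMeasure] {P : Set V}
    (hP : IsPolytope P) {x₀ : V} (hx₀ : x₀ ∈ interior P) :
    ∃ 𝓕 : Finset (Set V), (∀ F ∈ 𝓕, IsFacetOf F P) ∧ (frontier P ⊆ ⋃ F ∈ 𝓕, F) ∧
      ν (P \ ⋃ F ∈ 𝓕, coneOver x₀ F) = 0 := by
  classical
  have hconv := hP.convex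
  obtain ⟨hcomp, hint, s, hs, rfl⟩ := hP
  set P := {x : V | ∀ l ∈ s, 0 ≤ l x} with hPdef
  set face : (V →ᵃ[ℝ] ℝ) → Set V := fun l => P ∩ {x | l x = 0} with hface
  have hpos : ∀ l ∈ s, 0 < l x₀ := fun l hl =>
    affine_pos_of_mem_interior (P := P) (hs l hl) (fun x hx => hx l hl) hx₀
  have hfc : ∀ l, IsCompact (face l) := fun l => hcomp.inter_right
    (isClosed_singleton.preimage l.continuous_of_finiteDimensional)
  set 𝓕 := (s.image face).filter fun F => IsFacetOf F P with h𝓕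
  -- A non-empty face that is not a facet has codimension at least two, and adding the apex raises
  -- the dimension of its span by at most one.
  have hsmall : ∀ l ∈ s, face l ∉ 𝓕 → ν (coneOver x₀ (face l)) = 0 := by
    intro l hl hn
    rcases (face l).eq_empty_or_nonempty with he | hne
    · simp [he, coneOver]
    · have h1 := finrank_direction_affineSpan_face_lt (P := P) (hs l hl)
      apply measure_coneOver_eq_zero
      refine lt_of_le_of_ne h1 fun heq => hn ?_
      exact Finset.mem_filter.2 ⟨Finset.mem_image_of_mem _ hl,
        ⟨l, hs l hl, fun x hx => hx l hl, rfl⟩, hne, heq⟩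
  have hnull : ν (P \ ⋃ F ∈ 𝓕, coneOver x₀ F) = 0 := by
    have hsub : P \ ⋃ F ∈ 𝓕, coneOver x₀ F ⊆
        {x₀} ∪ ⋃ l ∈ s.filter (fun l => face l ∉ 𝓕), coneOver x₀ (face l) := by
      rintro z ⟨hz, hzn⟩
      by_cases hzx : z = x₀
      · exact Or.inl hzx
      · obtain ⟨l, hl, hzl⟩ := exists_mem_coneOver hcomp hz hzx
        refine Or.inr (mem_iUnion₂.2 ⟨l, Finset.mem_filter.2 ⟨hl, fun hmem => hzn ?_⟩, hzl⟩)
        exact mem_iUnion₂.2 ⟨_, hmem, hzl⟩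
    refine measure_mono_null hsub (measure_union_null (measure_singleton x₀) ?_)
    refine (measure_biUnion_null_iff (Finset.countable_toSet _)).2 fun l hl => ?_
    obtain ⟨hl, hn⟩ := Finset.mem_filter.1 hl
    exact hsmall l hl hn
  refine ⟨𝓕, fun F hF => (Finset.mem_filter.1 hF).2, ?_, hnull⟩
  -- A boundary point outside all facets lies on no cone, since a point of a cone strictly before
  -- its base is positive under every defining function. The cones form a closed set, so they would
  -- miss a non-empty open part of `P` near `y`, which has positive measure.
  intro y hy
  by_contra hyn
  have hyP : y ∈ P := hcomp.isClosed.frontier_subset hy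
  obtain ⟨j, hj, hjy⟩ := exists_eq_zero_of_mem_frontier hy hcomp.isClosed
  have hycone : ∀ F ∈ 𝓕, y ∉ coneOver x₀ F := by
    rintro F hF ⟨⟨r, z⟩, ⟨hr, hz⟩, hrz⟩
    have hzP : z ∈ P := by
      obtain ⟨⟨l, -, -, rfl⟩, -⟩ := (Finset.mem_filter.1 hF).2
      exact hz.1
    have h1 : (1 - r) * j x₀ + r * j z = 0 := by
      have h2 := j.apply_lineMap x₀ z r
      simp only at hrz hr
      rw [hrz, hjy, AffineMap.lineMap_apply_module] at h2
      simpa using h2.symm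
    have hr1 : r = 1 := by
      by_contra hne
      have : r < 1 := lt_of_le_of_ne hr.2 hne
      have h3 : 0 < (1 - r) * j x₀ := mul_pos (by linarith) (hpos j hj)
      have h4 : 0 ≤ r * j z := mul_nonneg hr.1 (hzP j hj)
      linarith
    subst hr1
    simp only [AffineMap.lineMap_apply_one] at hrz
    subst hrz
    exact hyn (mem_iUnion₂.2 ⟨F, hF, hz⟩)
  have hclosed : IsClosed (⋃ F ∈ 𝓕, coneOver x₀ F) := by
    refine isClosed_biUnion_finset fun F hF => IsCompact.isClosed (isCompact_coneOver x₀ ?_)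
    obtain ⟨l, -, rfl⟩ := Finset.mem_image.1 (Finset.mem_filter.1 hF).1
    exact hfc l
  have hycl : y ∈ closure (interior P) := by
    rw [hconv.closure_interior_eq_closure_of_nonempty_interior hint]
    exact subset_closure hyP
  have hO : (⋃ F ∈ 𝓕, coneOver x₀ F)ᶜ ∈ 𝓝 y := by
    refine hclosed.isOpen_compl.mem_nhds fun hmem => ?_
    obtain ⟨F, hF, hyF⟩ := mem_iUnion₂.1 hmem
    exact hycone F hF hyF
  obtain ⟨z, hz1, hz2⟩ := mem_closure_iff_nhds.1 hycl _ hO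
  have hopen : IsOpen ((⋃ F ∈ 𝓕, coneOver x₀ F)ᶜ ∩ interior P) :=
    hclosed.isOpen_compl.inter isOpen_interior
  have := hopen.measure_pos ν ⟨z, hz1, hz2⟩
  refine this.ne' (measure_mono_null ?_ hnull)
  exact fun w hw => ⟨interior_subset hw.2, hw.1⟩

end Geometry

/-! ### Integration over the cone on a facet. -/

section ConeIntegral

variable {V : Type*} [NormedAddCommGroup V] [NormedSpace ℝ V]

theorem isCompact_of_isFacetOf [FiniteDimensional ℝ V] {P F : Set V} (hP : IsPolytope P)
    (hF : IsFacetOf F P) : IsCompact F := by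
  obtain ⟨⟨l, -, -, rfl⟩, -⟩ := hF
  exact hP.1.inter_right (isClosed_singleton.preimage l.continuous_of_finiteDimensional)

variable [FiniteDimensional ℝ V] [MeasurableSpace V] [BorelSpace V]

theorem IsFlatOn.measure_univ_lt_top {m : Measure V} {F : Set V} (hF : IsCompact F)
    (hm : IsFlatOn m F) : m univ < ∞ := by
  obtain ⟨x, -, ν, hν, rfl⟩ := hm
  have hemb : IsClosedEmbedding fun v : (affineSpan ℝ F).direction => x + (v : V) :=
    (Homeomorph.addLeft x).isClosedEmbedding.comp
      (Submodule.closed_of_finiteDimensional _).isClosedEmbedding_subtypeVal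
  rw [Measure.restrict_apply_univ, Measure.map_apply hemb.continuous.measurable
    hF.isClosed.measurableSet]
  exact (hemb.isCompact_preimage hF).measure_lt_top

/-- The integral over the cone with apex `x₀` over a facet is bounded by the iterated integral
along the segments from `x₀` to the points of the facet. -/
theorem IsFlatOn.lintegral_coneOver_le (ν : Measure V) [ν.IsAddHaarMeasure] {P F : Set V}
    (hP : IsPolytope P) (hF : IsFacetOf F P) {x₀ : V} (hx₀ : x₀ ∈ interior P) {m : Measure V}
    (hm : IsFlatOn m F) :
    ∃ C : ℝ≥0∞, C ≠ ∞ ∧ ∀ f : V → ℝ≥0∞, Measurable f →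
      ∫⁻ z in coneOver x₀ F, f z ∂ν ≤
        C * ∫⁻ y, (∫⁻ r in Ioo (0 : ℝ) 1, f (AffineMap.lineMap x₀ y r)) ∂m := by
  have hFc := isCompact_of_isFacetOf hP hF
  obtain ⟨x, hxF, ρ, hρ, rfl⟩ := hm
  obtain ⟨⟨l, hl, hlP, hFl⟩, -, hdim⟩ := hF
  have hl0 : 0 < l x₀ := affine_pos_of_mem_interior hl hlP hx₀
  let W : Submodule ℝ V := (affineSpan ℝ F).direction
  have hW : W = (affineSpan ℝ F).direction := rfl
  have hker : ∀ w ∈ W, l.linear w = 0 := fun w hw => by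
    rw [hW, hFl] at hw
    exact direction_affineSpan_face_le_ker P l hw
  have hlx : l x = 0 := by rw [hFl] at hxF; exact hxF.2
  set d : V := x - x₀ with hd
  have hld : l.linear d ≠ 0 := by
    have : l.linear (x -ᵥ x₀) = l x -ᵥ l x₀ := l.linearMap_vsub x x₀
    rw [hd, ← vsub_eq_sub, this, hlx]
    simpa using hl0.ne'
  -- Coordinates adapted to the cone: relative to `x₀`, its slice at height `r` is `r • (F - x)`
  -- shifted by `r • d`.
  set e₀ : (W × ℝ) →ₗ[ℝ] V := W.subtype.coprod (LinearMap.toSpanSingleton ℝ V d) with he₀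
  have he₀_apply : ∀ p : W × ℝ, e₀ p = (p.1 : V) + p.2 • d := fun p => by simp [he₀]
  have hinj : Function.Injective e₀ := by
    rw [← LinearMap.ker_eq_bot, LinearMap.ker_eq_bot']
    rintro ⟨w, r⟩ h
    rw [he₀_apply] at h
    have h1 := congrArg l.linear h
    simp only [map_add, hker w w.2, map_smul, zero_add, map_zero, smul_eq_mul, mul_eq_zero,
      hld, or_false] at h1
    subst h1
    simpa using h
  set e : (W × ℝ) ≃L[ℝ] V := (LinearEquiv.ofInjectiveOfFinrankEq e₀ hinj
    (by simpa using hdim)).toContinuousLinearEquiv with he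
  have he_apply : ∀ p : W × ℝ, e p = (p.1 : V) + p.2 • d := fun p => he₀_apply p
  set ν' : Measure V := (ρ.prod volume).map e with hν'
  have hν'h : ν'.IsAddHaarMeasure := e.isAddHaarMeasure_map _
  obtain ⟨c, hmul⟩ : ∃ c : NNReal, ν = c • ν' :=
    ⟨_, Measure.isAddLeftInvariant_eq_smul _ _⟩
  refine ⟨c, ENNReal.coe_ne_top, fun f hf => ?_⟩
  have hcm : MeasurableSet (coneOver x₀ F) := (isCompact_coneOver x₀ hFc).measurableSet
  set k : ℝ → W → ℝ≥0∞ := fun r v =>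
    F.indicator (fun y => f (AffineMap.lineMap x₀ y r)) (x + v) with hk
  have hline : Continuous fun p : ℝ × V => (AffineMap.lineMap x₀ p.2 p.1 : V) := by
    simp only [AffineMap.lineMap_apply_module]; fun_prop
  have hkm : Measurable (Function.uncurry k) := by
    have h1 : Measurable fun p : ℝ × V =>
        (Prod.snd ⁻¹' F).indicator (fun p : ℝ × V => f (AffineMap.lineMap x₀ p.2 p.1)) p :=
      (hf.comp hline.measurable).indicator (measurable_snd hFc.measurableSet)
    have h2 : Measurable fun q : ℝ × W => ((q.1, x + (q.2 : V)) : ℝ × V) := by fun_prop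
    exact h1.comp h2
  have hcone : ∀ (w : W) (r : ℝ), x₀ + e (w, r) ∈ coneOver x₀ F →
      r ∈ Icc (0 : ℝ) 1 ∧ ∃ v : W, x + (v : V) ∈ F ∧ w = r • v := by
    rintro w r ⟨⟨t, y⟩, ⟨ht, hy⟩, hty⟩
    have hyW : y - x ∈ W := by
      rw [← vsub_eq_sub]
      exact AffineSubspace.vsub_mem_direction (mem_affineSpan ℝ hy) (mem_affineSpan ℝ hxF)
    have h1 : e (w, r) = e (t • (⟨y - x, hyW⟩ : W), t) := by
      rw [he_apply (t • (⟨y - x, hyW⟩ : W), t)]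
      have : (AffineMap.lineMap x₀ y t : V) = x₀ + e (w, r) := hty
      rw [AffineMap.lineMap_apply, vsub_eq_sub, vadd_eq_add, add_comm] at this
      rw [← add_left_cancel this, hd]
      simp only [Submodule.coe_smul, ← smul_add]
      congr 1; abel
    have h2 := e.injective h1
    rw [Prod.mk.injEq] at h2
    obtain ⟨h2, rfl⟩ := h2
    exact ⟨ht, ⟨y - x, hyW⟩, by simpa using hy, h2⟩
  have hle : ∀ (r : ℝ), r ∈ Ioo (0 : ℝ) 1 → ∀ w : W,
      (coneOver x₀ F).indicator f (x₀ + e (w, r)) ≤ k r (r⁻¹ • w) := by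
    intro r hr w
    by_cases hmem : x₀ + e (w, r) ∈ coneOver x₀ F
    · obtain ⟨-, v, hv, rfl⟩ := hcone w r hmem
      rw [indicator_of_mem hmem, smul_smul, inv_mul_cancel₀ hr.1.ne', one_smul]
      simp only [hk]
      rw [indicator_of_mem hv, he_apply, AffineMap.lineMap_apply, hd]
      refine le_of_eq (congrArg f ?_)
      simp only [vsub_eq_sub, vadd_eq_add, Submodule.coe_smul, ← smul_add]
      rw [add_comm]; congr 2; abel
    · rw [indicator_of_notMem hmem]; exact zero_le
  have hzero : ∀ r : ℝ, r ∉ Icc (0 : ℝ) 1 → ∀ w : W,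
      (coneOver x₀ F).indicator f (x₀ + e (w, r)) = 0 := fun r hr w =>
    indicator_of_notMem (fun hmem => hr (hcone w r hmem).1) _
  -- Substituting `w = r • v` carries the slice to the facet with Jacobian `r ^ dim W`, which is at
  -- most `1` and is discarded.
  have hslice : ∀ r ∈ Ioo (0 : ℝ) 1, ∫⁻ w, (coneOver x₀ F).indicator f (x₀ + e (w, r)) ∂ρ ≤
      ∫⁻ v, k r v ∂ρ := by
    intro r hr
    have hkr : Measurable (k r) := hkm.comp measurable_prodMk_left
    calc ∫⁻ w, (coneOver x₀ F).indicator f (x₀ + e (w, r)) ∂ρ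
        ≤ ∫⁻ w, k r (r⁻¹ • w) ∂ρ := lintegral_mono (hle r hr)
      _ = ∫⁻ v, k r v ∂(ρ.map (r⁻¹ • ·)) := (lintegral_map hkr (measurable_const_smul _)).symm
      _ = ENNReal.ofReal |((r⁻¹) ^ Module.finrank ℝ W)⁻¹| * ∫⁻ v, k r v ∂ρ := by
          rw [Measure.map_addHaar_smul ρ (inv_ne_zero hr.1.ne'), lintegral_smul_measure,
            smul_eq_mul]
      _ ≤ 1 * ∫⁻ v, k r v ∂ρ := by
          gcongr
          rw [ENNReal.ofReal_le_one, inv_pow, inv_inv, abs_of_nonneg (pow_nonneg hr.1.le _)]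
          exact pow_le_one₀ hr.1.le hr.2.le
      _ = ∫⁻ v, k r v ∂ρ := one_mul _
  have hgm : Measurable ((coneOver x₀ F).indicator f) := hf.indicator hcm
  have hgm' : Measurable fun p : W × ℝ => (coneOver x₀ F).indicator f (x₀ + e p) :=
    hgm.comp (measurable_const.add e.continuous.measurable)
  have hfibre : ∫⁻ r, ∫⁻ w, (coneOver x₀ F).indicator f (x₀ + e (w, r)) ∂ρ =
      ∫⁻ r in Ioo (0 : ℝ) 1, ∫⁻ w, (coneOver x₀ F).indicator f (x₀ + e (w, r)) ∂ρ := by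
    rw [setLIntegral_congr Ioo_ae_eq_Icc, ← lintegral_indicator measurableSet_Icc]
    refine lintegral_congr fun r => ?_
    by_cases hr : r ∈ Icc (0 : ℝ) 1
    · rw [indicator_of_mem hr]
    · rw [indicator_of_notMem hr]; simp [hzero r hr]
  have htrans : ∫⁻ z in coneOver x₀ F, f z ∂ν =
      c * ∫⁻ r, ∫⁻ w, (coneOver x₀ F).indicator f (x₀ + e (w, r)) ∂ρ := by
    rw [← lintegral_indicator hcm, ← lintegral_add_left_eq_self _ x₀]
    rw [hmul, lintegral_smul_measure, hν', lintegral_map (by fun_prop) e.continuous.measurable,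
      lintegral_prod_symm _ hgm'.aemeasurable]
    rfl
  rw [htrans, hfibre]
  gcongr
  calc ∫⁻ r in Ioo (0 : ℝ) 1, ∫⁻ w, (coneOver x₀ F).indicator f (x₀ + e (w, r)) ∂ρ
      ≤ ∫⁻ r in Ioo (0 : ℝ) 1, ∫⁻ v, k r v ∂ρ := setLIntegral_mono' measurableSet_Ioo hslice
    _ = ∫⁻ v, (∫⁻ r in Ioo (0 : ℝ) 1, k r v) ∂ρ := lintegral_lintegral_swap hkm.aemeasurable
    _ = ∫⁻ v : W, F.indicator
          (fun y => ∫⁻ r in Ioo (0 : ℝ) 1, f (AffineMap.lineMap x₀ y r)) (x + v) ∂ρ := by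
        refine lintegral_congr fun v => ?_
        by_cases hv : x + (v : V) ∈ F
        · simp [hk, indicator_of_mem hv]
        · simp [hk, indicator_of_notMem hv]
    _ = _ := by
        have hm1 : Measurable fun y => ∫⁻ r in Ioo (0 : ℝ) 1, f (AffineMap.lineMap x₀ y r) :=
          Measurable.lintegral_prod_left' (hf.comp hline.measurable)
        rw [← lintegral_indicator hFc.measurableSet,
          lintegral_map (hm1.indicator hFc.measurableSet) (by fun_prop)]

end ConeIntegral

/-! ### Log convexity and measurability for functions with values in `[0, ∞]`. -/

/-- Log convexity on a convex set, for functions with values in `[0, ∞]`. -/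
def LogConvexOn {V : Type*} [AddCommGroup V] [Module ℝ V] (P : Set V) (u : V → ℝ≥0∞) : Prop :=
  ∀ x ∈ P, ∀ y ∈ P, ∀ t : ℝ, 0 ≤ t → t ≤ 1 →
    u ((1 - t) • x + t • y) ≤ u x ^ (1 - t) * u y ^ t

/-- Weighted arithmetic-geometric mean inequality. The endpoints are treated apart because the
argument for an infinite value needs both weights positive. -/
theorem ennreal_rpow_mul_rpow_le (a b : ℝ≥0∞) {t : ℝ} (h0 : 0 ≤ t) (h1 : t ≤ 1) :
    a ^ (1 - t) * b ^ t ≤ ENNReal.ofReal (1 - t) * a + ENNReal.ofReal t * b := by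
  rcases h0.eq_or_lt with rfl | h0
  · simp
  rcases h1.eq_or_lt with rfl | h1
  · simp
  have h1' : 0 < 1 - t := by linarith
  induction a using ENNReal.recTopCoe with
  | top => rw [ENNReal.mul_top (by simpa using h1)]; simp
  | coe a =>
    induction b using ENNReal.recTopCoe with
    | top => rw [ENNReal.mul_top (a := ENNReal.ofReal t) (by simpa using h0)]; simp
    | coe b =>
      have := NNReal.geom_mean_le_arith_mean2_weighted ⟨1 - t, h1'.le⟩ ⟨t, h0.le⟩ a b
        (NNReal.eq (by change 1 - t + t = 1; ring))
      rw [← ENNReal.coe_rpow_of_nonneg _ h1'.le, ← ENNReal.coe_rpow_of_nonneg _ h0.le,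
        ENNReal.ofReal_eq_coe_nnreal h1'.le, ENNReal.ofReal_eq_coe_nnreal h0.le]
      exact_mod_cast this

theorem LogConvexOn.convex_le {V : Type*} [AddCommGroup V] [Module ℝ V] {P : Set V}
    {u : V → ℝ≥0∞} (hu : LogConvexOn P u) {x y : V} (hx : x ∈ P) (hy : y ∈ P) {t : ℝ}
    (h0 : 0 ≤ t) (h1 : t ≤ 1) :
    u ((1 - t) • x + t • y) ≤ ENNReal.ofReal (1 - t) * u x + ENNReal.ofReal t * u y :=
  (hu x hx y hy t h0 h1).trans (ennreal_rpow_mul_rpow_le _ _ h0 h1)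

theorem measurable_indicator_of_lowerSemicontinuousOn {X : Type*} [TopologicalSpace X]
    [MeasurableSpace X] [OpensMeasurableSpace X] {P : Set X} (hP : MeasurableSet P)
    {u : X → ℝ≥0∞} (hu : LowerSemicontinuousOn u P) : Measurable (P.indicator u) := by
  refine measurable_of_Ioi fun b => ?_
  obtain ⟨O, hO, hOeq⟩ := lowerSemicontinuousOn_iff_preimage_Ioi.1 hu b
  have : P.indicator u ⁻¹' Ioi b = P ∩ O := by
    rw [← hOeq]
    ext x
    by_cases hx : x ∈ P <;> simp [hx]
  rw [this]
  exact hP.inter hO.measurableSet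

theorem setLIntegral_biUnion_finset_le {α ι : Type*} [MeasurableSpace α] (ν : Measure α)
    (s : Finset ι) (A : ι → Set α) (f : α → ℝ≥0∞) :
    ∫⁻ x in ⋃ i ∈ s, A i, f x ∂ν ≤ ∑ i ∈ s, ∫⁻ x in A i, f x ∂ν := by
  classical
  induction s using Finset.induction_on with
  | empty => simp
  | insert a s ha ih =>
    rw [Finset.set_biUnion_insert, Finset.sum_insert ha]
    exact (lintegral_union_le f _ _).trans (add_le_add_right ih _)

/-! ### Finiteness of the two measures, and bounds for states inside the polytope. -/

namespace System

variable {V : Type*} [NormedAddCommGroup V] [NormedSpace ℝ V] [FiniteDimensional ℝ V]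
  [MeasurableSpace V] [BorelSpace V] (sys : System V)

omit [FiniteDimensional ℝ V] [BorelSpace V] in
theorem isPolytope : IsPolytope sys.P := sys.simple.1

omit [FiniteDimensional ℝ V] in
theorem measurableSet_P : MeasurableSet sys.P := sys.isPolytope.isClosed.measurableSet

omit [FiniteDimensional ℝ V] [BorelSpace V] in
theorem ae_σ_mem_frontier : ∀ᵐ x ∂sys.σ, x ∈ frontier sys.P := sys.σ_carried

omit [FiniteDimensional ℝ V] [BorelSpace V] in
theorem ae_σ_mem : ∀ᵐ x ∂sys.σ, x ∈ sys.P :=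
  sys.ae_σ_mem_frontier.mono fun _ hx => sys.isPolytope.isClosed.frontier_subset hx

omit [FiniteDimensional ℝ V] in
theorem ae_μ_mem : ∀ᵐ x ∂sys.μ, x ∈ sys.P := by
  obtain ⟨ν, -, h⟩ := sys.μ_flat
  rw [h]
  exact ae_restrict_mem sys.measurableSet_P

theorem ae_μ_mem_interior : ∀ᵐ x ∂sys.μ, x ∈ interior sys.P := by
  obtain ⟨ν, hν, h⟩ := sys.μ_flat
  have h1 : ∀ᵐ x ∂sys.μ, x ∉ frontier sys.P := by
    have h2 : ν (frontier sys.P) = 0 := sys.isPolytope.convex.addHaar_frontier ν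
    have h3 : ∀ᵐ x ∂ν, x ∉ frontier sys.P := measure_eq_zero_iff_ae_notMem.1 h2
    rw [h]
    exact ae_restrict_of_ae h3
  filter_upwards [h1, sys.ae_μ_mem] with x hx hxP
  by_contra hn
  exact hx ⟨subset_closure hxP, hn⟩

omit [FiniteDimensional ℝ V] [BorelSpace V] in
theorem μ_univ_ne_zero : sys.μ univ ≠ 0 := by
  obtain ⟨ν, hν, h⟩ := sys.μ_flat
  rw [h, Measure.restrict_apply_univ]
  exact (Measure.measure_pos_of_nonempty_interior ν sys.isPolytope.2.1).ne'

omit [FiniteDimensional ℝ V] [BorelSpace V] in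
theorem μ_univ_ne_top : sys.μ univ ≠ ∞ := by
  obtain ⟨ν, hν, h⟩ := sys.μ_flat
  rw [h, Measure.restrict_apply_univ]
  exact sys.isPolytope.1.measure_lt_top.ne

instance isFiniteMeasure_μ : IsFiniteMeasure sys.μ := ⟨sys.μ_univ_ne_top.lt_top⟩

omit [FiniteDimensional ℝ V] [BorelSpace V] in
theorem σ_univ_eq_zero_of_subsingleton [Subsingleton V] : sys.σ univ = 0 := by
  have h1 : frontier sys.P = ∅ := by
    obtain ⟨x, hx⟩ := sys.isPolytope.2.1
    have : sys.P = univ := Subsingleton.eq_univ_of_nonempty ⟨x, interior_subset hx⟩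
    rw [this, frontier_univ]
  have h2 := sys.σ_carried
  rwa [h1, compl_empty] at h2

theorem σ_univ_lt_top : sys.σ univ < ∞ := by
  rcases subsingleton_or_nontrivial V with hV | hV
  · simp [sys.σ_univ_eq_zero_of_subsingleton]
  · obtain ⟨ν, hν, -⟩ := sys.μ_flat
    obtain ⟨x₀, hx₀⟩ := sys.isPolytope.2.1
    obtain ⟨𝓕, hF, hcov, -⟩ := sys.isPolytope.exists_facets ν hx₀
    calc sys.σ univ ≤ sys.σ (⋃ F ∈ 𝓕, F) := by
          refine measure_mono_ae ?_
          filter_upwards [sys.ae_σ_mem_frontier] with x hx _ using hcov hx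
      _ ≤ ∑ F ∈ 𝓕, sys.σ F := measure_biUnion_finset_le _ _
      _ < ∞ := by
          refine ENNReal.sum_lt_top.2 fun F hFm => ?_
          have := (sys.σ_flat F (hF F hFm)).measure_univ_lt_top
            (isCompact_of_isFacetOf sys.isPolytope (hF F hFm))
          rwa [Measure.restrict_apply_univ] at this

instance isFiniteMeasure_σ : IsFiniteMeasure sys.σ := ⟨sys.σ_univ_lt_top⟩

/-- Integrals over the polytope are bounded by iterated integrals along the segments from an
interior point to the boundary points. -/
theorem exists_lintegral_le_lintegral_segments [Nontrivial V] {x₀ : V}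
    (hx₀ : x₀ ∈ interior sys.P) :
    ∃ C : ℝ≥0∞, C ≠ ∞ ∧ ∀ f : V → ℝ≥0∞, Measurable f →
      ∫⁻ z, f z ∂sys.μ ≤
        C * ∫⁻ y, (∫⁻ r in Ioo (0 : ℝ) 1, f (AffineMap.lineMap x₀ y r)) ∂sys.σ := by
  obtain ⟨ν, hν, hμ⟩ := sys.μ_flat
  obtain ⟨𝓕, hF, -, hnull⟩ := sys.isPolytope.exists_facets ν hx₀
  have hex : ∀ F : Set V, ∃ C : ℝ≥0∞, F ∈ 𝓕 → C ≠ ∞ ∧ ∀ f : V → ℝ≥0∞, Measurable f →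
      ∫⁻ z in coneOver x₀ F, f z ∂ν ≤
        C * ∫⁻ y in F, (∫⁻ r in Ioo (0 : ℝ) 1, f (AffineMap.lineMap x₀ y r)) ∂sys.σ := by
    intro F
    by_cases hFm : F ∈ 𝓕
    · obtain ⟨C, hC, h⟩ := (sys.σ_flat F (hF F hFm)).lintegral_coneOver_le ν sys.isPolytope
        (hF F hFm) hx₀
      exact ⟨C, fun _ => ⟨hC, h⟩⟩
    · exact ⟨0, fun h => absurd h hFm⟩
  choose C hC using hex
  refine ⟨∑ F ∈ 𝓕, C F, ENNReal.sum_ne_top.2 fun F hFm => (hC F hFm).1, fun f hf => ?_⟩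
  have hae : sys.P ≤ᵐ[ν] ⋃ F ∈ 𝓕, coneOver x₀ F := ae_le_set.2 hnull
  calc ∫⁻ z, f z ∂sys.μ = ∫⁻ z in sys.P, f z ∂ν := by rw [hμ]
    _ ≤ ∫⁻ z in ⋃ F ∈ 𝓕, coneOver x₀ F, f z ∂ν := lintegral_mono_set' hae
    _ ≤ ∑ F ∈ 𝓕, ∫⁻ z in coneOver x₀ F, f z ∂ν := setLIntegral_biUnion_finset_le _ _ _ _
    _ ≤ ∑ F ∈ 𝓕, C F *
          ∫⁻ y, (∫⁻ r in Ioo (0 : ℝ) 1, f (AffineMap.lineMap x₀ y r)) ∂sys.σ := by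
        refine Finset.sum_le_sum fun F hFm => ((hC F hFm).2 f hf).trans ?_
        gcongr
        exact Measure.restrict_le_self
    _ = _ := by rw [Finset.sum_mul]

variable {sys} {u : V → ℝ≥0∞}

omit [FiniteDimensional ℝ V] [BorelSpace V] in
theorem IsState.logConvexOn (hu : sys.IsState u) : LogConvexOn sys.P u := hu.2.2.1

omit [FiniteDimensional ℝ V] in
theorem IsState.measurable_indicator (hu : sys.IsState u) : Measurable (sys.P.indicator u) :=
  measurable_indicator_of_lowerSemicontinuousOn sys.measurableSet_P hu.2.1

omit [FiniteDimensional ℝ V] in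
theorem IsState.aemeasurable_μ (hu : sys.IsState u) : AEMeasurable u sys.μ := by
  refine ⟨_, hu.measurable_indicator, ?_⟩
  filter_upwards [sys.ae_μ_mem] with x hx using (indicator_of_mem hx u).symm

omit [FiniteDimensional ℝ V] in
theorem IsState.aemeasurable_σ (hu : sys.IsState u) : AEMeasurable u sys.σ := by
  refine ⟨_, hu.measurable_indicator, ?_⟩
  filter_upwards [sys.ae_σ_mem] with x hx using (indicator_of_mem hx u).symm

omit [FiniteDimensional ℝ V] in
theorem IsState.ae_lt_top (hu : sys.IsState u) : ∀ᵐ x ∂sys.μ, u x < ∞ :=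
  ae_lt_top' hu.aemeasurable_μ (by rw [hu.2.2.2]; exact sys.μ_univ_ne_top)

/-- The mean value bound: states are bounded, uniformly, at points at a given distance from the
boundary. -/
theorem exists_state_le {δ : ℝ} (hδ : 0 < δ) :
    ∃ K : ℝ≥0∞, K ≠ ∞ ∧ ∀ u, sys.IsState u → ∀ x, Metric.ball x δ ⊆ sys.P → u x ≤ K := by
  obtain ⟨ν, hν, hμ⟩ := sys.μ_flat
  set B : Set V := Metric.ball 0 δ with hB
  have hB0 : ν B ≠ 0 := (Metric.measure_ball_pos ν 0 hδ).ne'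
  have hBt : ν B ≠ ∞ := measure_ball_lt_top.ne
  refine ⟨sys.μ univ / ν B, ENNReal.div_ne_top sys.μ_univ_ne_top hB0, fun u hu x hx => ?_⟩
  rw [ENNReal.le_div_iff_mul_le (Or.inl hB0) (Or.inl hBt)]
  set g := sys.P.indicator u with hg
  have hgm : Measurable g := hu.measurable_indicator
  have hgi : ∫⁻ z, g z ∂ν = sys.μ univ := by
    rw [hg, lintegral_indicator sys.measurableSet_P, ← hμ, hu.2.2.2]
  -- Averaging this midpoint inequality over the ball gives a mean value property, and the total
  -- mass of a state is prescribed.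
  have hpt : ∀ h ∈ B, u x ≤ 2⁻¹ * g (x + h) + 2⁻¹ * g (x - h) := by
    intro h hh
    have hh' : ‖h‖ < δ := by simpa [hB] using hh
    have h1 : x + h ∈ sys.P := hx (by simpa [Metric.mem_ball, dist_eq_norm] using hh')
    have h2 : x - h ∈ sys.P := hx (by simpa [Metric.mem_ball, dist_eq_norm] using hh')
    have h3 := hu.logConvexOn.convex_le h1 h2 (t := 1 / 2) (by norm_num) (by norm_num)
    have h4 : ((1 : ℝ) - 1 / 2) • (x + h) + (1 / 2 : ℝ) • (x - h) = x := by module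
    have h5 : ENNReal.ofReal (1 / 2) = 2⁻¹ := by
      rw [one_div, ENNReal.ofReal_inv_of_pos (by norm_num)]; simp
    rw [h4, show (1 : ℝ) - 1 / 2 = 1 / 2 by norm_num, h5] at h3
    rwa [hg, indicator_of_mem h1, indicator_of_mem h2]
  calc u x * ν B = ∫⁻ _ in B, u x ∂ν := by rw [setLIntegral_const]
    _ ≤ ∫⁻ h in B, (2⁻¹ * g (x + h) + 2⁻¹ * g (x - h)) ∂ν :=
        setLIntegral_mono' Metric.isOpen_ball.measurableSet hpt
    _ ≤ ∫⁻ h, (2⁻¹ * g (x + h) + 2⁻¹ * g (x - h)) ∂ν := setLIntegral_le_lintegral _ _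
    _ = 2⁻¹ * sys.μ univ + 2⁻¹ * sys.μ univ := by
        rw [lintegral_add_left (by fun_prop), lintegral_const_mul _ (by fun_prop),
          lintegral_const_mul _ (by fun_prop), lintegral_add_left_eq_self g x,
          lintegral_sub_left_eq_self g x, hgi]
    _ = sys.μ univ := by rw [← add_mul, ENNReal.inv_two_add_inv_two, one_mul]

end System

/-! ### Pointwise inequalities for `a log a`. -/

/-- The integrand `a log a + 1 ≥ 0` of the negative entropy, on `[0, ∞]`. -/
noncomputable def mulLogAddOne (a : ℝ≥0∞) : ℝ≥0∞ :=
  ENNReal.ofReal (a.toReal * Real.log a.toReal + 1)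

theorem measurable_mulLogAddOne : Measurable mulLogAddOne := by
  unfold mulLogAddOne; fun_prop

theorem mulLog_add_one_nonneg {a : ℝ} (ha : 0 ≤ a) : 0 ≤ a * Real.log a + 1 := by
  linarith [Real.self_sub_one_le_mul_log ha]

/-- This is `a - 1 ≤ a log a`. Integrated against the mass constraint it makes entropies
non-positive, and its equality case `a = 1` identifies the states of entropy zero. -/
theorem le_mulLogAddOne {a : ℝ≥0∞} (ha : a < ∞) : a ≤ mulLogAddOne a := by
  conv_lhs => rw [← ENNReal.ofReal_toReal ha.ne]
  exact ENNReal.ofReal_le_ofReal (by linarith [Real.self_sub_one_le_mul_log a.toReal_nonneg])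

theorem eq_one_of_mulLogAddOne_eq {a : ℝ≥0∞} (h : a = mulLogAddOne a) : a = 1 := by
  by_contra hne
  have h1 : a.toReal ≠ 1 := fun h1 => hne (by rwa [ENNReal.toReal_eq_one_iff] at h1)
  have h2 := Real.self_sub_one_lt_mul_log a.toReal_nonneg h1
  have h3 := congrArg ENNReal.toReal h
  rw [mulLogAddOne, ENNReal.toReal_ofReal (mulLog_add_one_nonneg a.toReal_nonneg)] at h3
  linarith

theorem tendsto_mulLogAddOne {a : ℝ≥0∞} (ha : a < ∞) :
    Tendsto mulLogAddOne (𝓝 a) (𝓝 (mulLogAddOne a)) :=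
  ENNReal.tendsto_ofReal ((Real.continuous_mul_log.continuousAt.tendsto.comp
    (ENNReal.tendsto_toReal ha.ne)).add_const 1)

/-- Although `a log a` is not monotone near `0`, it is non-positive on `[0, 1]`; this is why `1 ≤ c`
suffices. -/
theorem mulLog_le_mulLog {a c : ℝ} (ha : 0 ≤ a) (hac : a ≤ c) (hc : 1 ≤ c) :
    a * Real.log a ≤ c * Real.log c := by
  rcases ha.eq_or_lt with rfl | ha
  · simpa using mul_nonneg (by linarith) (Real.log_nonneg hc)
  · rcases le_total 0 (Real.log a) with hl | hl
    · exact mul_le_mul hac (Real.log_le_log ha hac) hl (by linarith)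
    · exact (mul_nonpos_of_nonneg_of_nonpos ha.le hl).trans
        (mul_nonneg (by linarith) (Real.log_nonneg hc))

theorem mulLogAddOne_mix_le {a b : ℝ≥0∞} (ha : a < ∞) (hb : b < ∞) {t : ℝ} (h0 : 0 ≤ t)
    (h1 : t ≤ 1) :
    mulLogAddOne (ENNReal.ofReal (1 - t) * a + ENNReal.ofReal t * b) ≤
      ENNReal.ofReal (1 - t) * mulLogAddOne a + ENNReal.ofReal t * mulLogAddOne b := by
  have h1' : 0 ≤ 1 - t := by linarith
  have h2 : (ENNReal.ofReal (1 - t) * a + ENNReal.ofReal t * b).toReal =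
      (1 - t) * a.toReal + t * b.toReal := by
    rw [ENNReal.toReal_add (ENNReal.mul_ne_top ENNReal.ofReal_ne_top ha.ne)
      (ENNReal.mul_ne_top ENNReal.ofReal_ne_top hb.ne), ENNReal.toReal_mul, ENNReal.toReal_mul,
      ENNReal.toReal_ofReal h1', ENNReal.toReal_ofReal h0]
  have ha' := mulLog_add_one_nonneg a.toReal_nonneg
  have hb' := mulLog_add_one_nonneg b.toReal_nonneg
  unfold mulLogAddOne
  rw [h2, ← ENNReal.ofReal_mul h1', ← ENNReal.ofReal_mul h0,
    ← ENNReal.ofReal_add (by positivity) (by positivity)]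
  apply ENNReal.ofReal_le_ofReal
  have := Real.convexOn_mul_log.2 (mem_Ici.2 a.toReal_nonneg) (mem_Ici.2 b.toReal_nonneg) h1' h0
    (by ring)
  simp only [smul_eq_mul] at this
  linarith

/-- Uniform convexity of `a log a`, measured by the square roots. -/
theorem mulLog_midpoint_add_le {a b : ℝ} (ha : 0 ≤ a) (hb : 0 ≤ b) :
    (a + b) / 2 * Real.log ((a + b) / 2) + (√a - √b) ^ 2 / 4 ≤
      (a * Real.log a + b * Real.log b) / 2 := by
  set m := (a + b) / 2 with hm
  -- This is `log y ≤ y - 1` at `y = √m / √c`. Adding the cases `c = a, b` and using `a + b = 2m`,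
  -- the difference from the claim is a positive multiple of `(√m - (√a + √b) / 2) ^ 2`.
  have key : ∀ c : ℝ, 0 ≤ c → 0 < m → 2 * c - 2 * √c * √m ≤ c * Real.log c - c * Real.log m := by
    intro c hc hmp
    rcases hc.eq_or_lt with rfl | hc
    · simp
    · have hsc := Real.sqrt_pos.2 hc
      have hsm := Real.sqrt_pos.2 hmp
      have h1 := Real.log_le_sub_one_of_pos (div_pos hsm hsc)
      rw [Real.log_div hsm.ne' hsc.ne', Real.log_sqrt hc.le, Real.log_sqrt hmp.le] at h1
      have h2 : c * (√m / √c) = √c * √m := by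
        field_simp
        rw [Real.sq_sqrt hc.le]
      nlinarith
  have hm0 : 0 ≤ m := by positivity
  rcases hm0.eq_or_lt with h0 | hmp
  · have ha0 : a = 0 := by linarith
    have hb0 : b = 0 := by linarith
    simp [hm, ha0, hb0]
  · have h1 := key a ha hmp
    have h2 := key b hb hmp
    have hsa := Real.sq_sqrt ha
    have hsb := Real.sq_sqrt hb
    have hsm := Real.sq_sqrt hm0
    have hab : a + b = 2 * m := by rw [hm]; ring
    have h3 : a * Real.log m + b * Real.log m = 2 * (m * Real.log m) := by
      rw [← add_mul, hab]; ring
    nlinarith [sq_nonneg (√m - (√a + √b) / 2)]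

theorem mulLogAddOne_midpoint_add_le {a b : ℝ≥0∞} (ha : a < ∞) (hb : b < ∞) :
    mulLogAddOne (ENNReal.ofReal (1 - 1 / 2) * a + ENNReal.ofReal (1 / 2) * b) +
      ENNReal.ofReal ((√a.toReal - √b.toReal) ^ 2 / 4) ≤
      ENNReal.ofReal (1 / 2) * (mulLogAddOne a + mulLogAddOne b) := by
  have h2 : (ENNReal.ofReal (1 - 1 / 2) * a + ENNReal.ofReal (1 / 2) * b).toReal =
      (a.toReal + b.toReal) / 2 := by
    rw [ENNReal.toReal_add (ENNReal.mul_ne_top ENNReal.ofReal_ne_top ha.ne)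
      (ENNReal.mul_ne_top ENNReal.ofReal_ne_top hb.ne), ENNReal.toReal_mul, ENNReal.toReal_mul,
      ENNReal.toReal_ofReal (by norm_num), ENNReal.toReal_ofReal (by norm_num)]
    ring
  have ha' := mulLog_add_one_nonneg a.toReal_nonneg
  have hb' := mulLog_add_one_nonneg b.toReal_nonneg
  have h3 : 0 ≤ (a.toReal + b.toReal) / 2 := by positivity
  have hm := mulLog_add_one_nonneg h3
  unfold mulLogAddOne
  rw [h2, ← ENNReal.ofReal_add hm (by positivity), ← ENNReal.ofReal_add ha' hb',
    ← ENNReal.ofReal_mul (by norm_num)]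
  apply ENNReal.ofReal_le_ofReal
  linarith [mulLog_midpoint_add_le a.toReal_nonneg b.toReal_nonneg]

/-- The key one-dimensional bound: the integral of `c log c + 1` for `c = K b ^ r` over the unit
interval is bounded by a multiple of `b`. -/
theorem lintegral_mulLog_rpow_le {K b : ℝ} (hK : 1 ≤ K) (hb : 1 ≤ b) :
    ∫⁻ r in Ioo (0 : ℝ) 1, ENNReal.ofReal (K * b ^ r * Real.log (K * b ^ r) + 1) ≤
      ENNReal.ofReal ((K * Real.log K + K + 1) * b) := by
  have hb0 : 0 < b := by linarith
  have hK0 : 0 < K := by linarith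
  have hlK := Real.log_nonneg hK
  have hlb := Real.log_nonneg hb
  have hcont : Continuous fun r : ℝ => b ^ r := Real.continuous_const_rpow hb0.ne'
  -- Bounding the factor `r` in `log (b ^ r) = r log b` by `1` leaves the exact derivative `b ^ r
  -- log b` of `b ^ r`, so that no `log b` survives the integration.
  have hpt : ∀ r ∈ Ioo (0 : ℝ) 1, ENNReal.ofReal (K * b ^ r * Real.log (K * b ^ r) + 1) ≤
      ENNReal.ofReal (K * Real.log K * b + 1 + K * (b ^ r * Real.log b)) := by
    intro r hr
    apply ENNReal.ofReal_le_ofReal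
    have hbr : 0 < b ^ r := Real.rpow_pos_of_pos hb0 r
    rw [Real.log_mul hK0.ne' hbr.ne', Real.log_rpow hb0]
    have h1 : b ^ r ≤ b := by
      simpa using Real.rpow_le_rpow_of_exponent_le hb hr.2.le
    have h2 : K * b ^ r * Real.log K ≤ K * Real.log K * b := by
      have := mul_le_mul_of_nonneg_left h1 (mul_nonneg hK0.le hlK)
      linarith
    have h3 : K * b ^ r * (r * Real.log b) ≤ K * (b ^ r * Real.log b) := by
      have := mul_le_mul_of_nonneg_right hr.2.le (by positivity : 0 ≤ K * (b ^ r * Real.log b))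
      linarith
    linarith
  refine (setLIntegral_mono' measurableSet_Ioo hpt).trans ?_
  have hc2 : Continuous fun r : ℝ => K * Real.log K * b + 1 + K * (b ^ r * Real.log b) := by
    fun_prop
  rw [← ofReal_integral_eq_lintegral_ofReal]
  · apply ENNReal.ofReal_le_ofReal
    rw [← integral_Ioc_eq_integral_Ioo, ← intervalIntegral.integral_of_le zero_le_one,
      intervalIntegral.integral_add (by simp) (by
        apply Continuous.intervalIntegrable; fun_prop), intervalIntegral.integral_const,
      intervalIntegral.integral_const_mul, intervalIntegral.integral_eq_sub_of_hasDerivAt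
        (f := fun r => b ^ r) (fun r _ => (Real.hasStrictDerivAt_const_rpow hb0 r).hasDerivAt)
        (by apply Continuous.intervalIntegrable; fun_prop)]
    simp only [sub_zero, one_smul, Real.rpow_one, Real.rpow_zero]
    nlinarith
  · exact (hc2.integrableOn_Icc (a := 0) (b := 1)).mono_set Ioo_subset_Icc_self
  · refine ae_of_all _ fun r => ?_
    have hbr : 0 < b ^ r := Real.rpow_pos_of_pos hb0 r
    simp only [Pi.zero_apply]
    positivity

/-! ### Mixtures of states and concavity of the entropy. -/

theorem ennreal_rpow_mul_add_le (a b c d : ℝ≥0∞) {s : ℝ} (h0 : 0 < s) (h1 : s < 1) :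
    a ^ (1 - s) * b ^ s + c ^ (1 - s) * d ^ s ≤ (a + c) ^ (1 - s) * (b + d) ^ s := by
  have h1' : 0 < 1 - s := by linarith
  have hpq : (1 / (1 - s)).HolderConjugate (1 / s) := by
    rw [Real.holderConjugate_iff]
    refine ⟨by rw [lt_div_iff₀ h1']; linarith, by simp⟩
  have := ENNReal.inner_le_Lp_mul_Lq (Finset.univ : Finset (Fin 2)) ![a ^ (1 - s), c ^ (1 - s)]
    ![b ^ s, d ^ s] hpq
  simpa [Fin.sum_univ_two, ← ENNReal.rpow_mul, h1'.ne', h0.ne'] using this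

/-- The mixture `(1 - t) u + t v`. -/
noncomputable def mix {V : Type*} (t : ℝ) (u v : V → ℝ≥0∞) : V → ℝ≥0∞ :=
  fun x => ENNReal.ofReal (1 - t) * u x + ENNReal.ofReal t * v x

/-- Sums of log convex functions are log convex by Hölder's inequality for two terms with exponents
`1 / (1 - s)` and `1 / s`; a constant factor splits as its powers `1 - s` and `s`. -/
theorem LogConvexOn.mix {V : Type*} [AddCommGroup V] [Module ℝ V] {P : Set V} {u v : V → ℝ≥0∞}
    (hu : LogConvexOn P u) (hv : LogConvexOn P v) (t : ℝ) : LogConvexOn P (mix t u v) := by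
  intro x hx y hy s h0 h1
  rcases h0.eq_or_lt with rfl | h0
  · simp
  rcases h1.eq_or_lt with rfl | h1
  · simp
  have key : ∀ c a b : ℝ≥0∞, c * (a ^ (1 - s) * b ^ s) = (c * a) ^ (1 - s) * (c * b) ^ s := by
    intro c a b
    rw [ENNReal.mul_rpow_of_nonneg _ _ (by linarith : 0 ≤ 1 - s),
      ENNReal.mul_rpow_of_nonneg _ _ h0.le, mul_mul_mul_comm,
      ← ENNReal.rpow_add_of_nonneg _ _ (by linarith : 0 ≤ 1 - s) h0.le, sub_add_cancel,
      ENNReal.rpow_one]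
  refine le_trans ?_ (ennreal_rpow_mul_add_le _ _ _ _ h0 h1)
  rw [← key, ← key]
  exact add_le_add (mul_le_mul_right (hu x hx y hy s h0.le h1.le) _)
    (mul_le_mul_right (hv x hx y hy s h0.le h1.le) _)

namespace System

variable {V : Type*} [NormedAddCommGroup V] [NormedSpace ℝ V]
  [MeasurableSpace V] {sys : System V} {u v : V → ℝ≥0∞}

/-- The integral of `u log u + 1`. -/
noncomputable def negEntropy (sys : System V) (u : V → ℝ≥0∞) : ℝ≥0∞ :=
  ∫⁻ x, mulLogAddOne (u x) ∂sys.μ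

variable [BorelSpace V]

theorem IsState.mix (hu : sys.IsState u) (hv : sys.IsState v) {t : ℝ} (h0 : 0 ≤ t) (h1 : t ≤ 1) :
    sys.IsState (mix t u v) := by
  have hlsc : ∀ (c : ℝ) (w : V → ℝ≥0∞), LowerSemicontinuousOn w sys.P →
      LowerSemicontinuousOn (fun x => ENNReal.ofReal c * w x) sys.P := fun c w hw =>
    (ENNReal.continuous_const_mul ENNReal.ofReal_ne_top).comp_lowerSemicontinuousOn hw
      fun _ _ h => mul_le_mul_right h _
  have h01 : ENNReal.ofReal (1 - t) + ENNReal.ofReal t = 1 := by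
    rw [← ENNReal.ofReal_add (by linarith) h0]; simp
  refine ⟨fun x hx => ?_, (hlsc _ u hu.2.1).add (hlsc _ v hv.2.1),
    hu.logConvexOn.mix hv.logConvexOn t, ?_⟩
  · rcases h0.eq_or_lt with rfl | h0
    · simpa [NAThermo.mix] using hu.1 x hx
    · exact (ENNReal.mul_pos (by simpa using h0) (hv.1 x hx).ne').trans_le le_add_self
  · unfold NAThermo.mix
    rw [lintegral_add_left' (hu.aemeasurable_μ.const_mul _),
      lintegral_const_mul'' _ hu.aemeasurable_μ, lintegral_const_mul'' _ hv.aemeasurable_μ,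
      hu.2.2.2, hv.2.2.2, ← add_mul, h01, one_mul]

theorem IsState.lintegral_σ_mix (hu : sys.IsState u) (hv : sys.IsState v) (t : ℝ) :
    ∫⁻ x, NAThermo.mix t u v x ∂sys.σ =
      ENNReal.ofReal (1 - t) * ∫⁻ x, u x ∂sys.σ + ENNReal.ofReal t * ∫⁻ x, v x ∂sys.σ := by
  unfold NAThermo.mix
  rw [lintegral_add_left' (hu.aemeasurable_σ.const_mul _),
      lintegral_const_mul'' _ hu.aemeasurable_σ, lintegral_const_mul'' _ hv.aemeasurable_σ]

theorem IsState.aemeasurable_mulLogAddOne (hu : sys.IsState u) :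
    AEMeasurable (fun x => mulLogAddOne (u x)) sys.μ :=
  measurable_mulLogAddOne.comp_aemeasurable hu.aemeasurable_μ

theorem IsState.negEntropy_mix_le (hu : sys.IsState u) (hv : sys.IsState v) {t : ℝ} (h0 : 0 ≤ t)
    (h1 : t ≤ 1) :
    sys.negEntropy (NAThermo.mix t u v) ≤
      ENNReal.ofReal (1 - t) * sys.negEntropy u + ENNReal.ofReal t * sys.negEntropy v := by
  unfold negEntropy
  rw [← lintegral_const_mul'' _ hu.aemeasurable_mulLogAddOne,
    ← lintegral_const_mul'' _ hv.aemeasurable_mulLogAddOne,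
    ← lintegral_add_left' (hu.aemeasurable_mulLogAddOne.const_mul _)]
  apply lintegral_mono_ae
  filter_upwards [hu.ae_lt_top, hv.ae_lt_top] with x hx hy using mulLogAddOne_mix_le hx hy h0 h1

/-- Within a family closed under midpoints, two states of nearly largest entropy therefore have
square roots close in `L²`. -/
theorem IsState.negEntropy_midpoint_add_le (hu : sys.IsState u) (hv : sys.IsState v) :
    sys.negEntropy (NAThermo.mix (1 / 2) u v) +
        ∫⁻ x, ENNReal.ofReal ((√(u x).toReal - √(v x).toReal) ^ 2 / 4) ∂sys.μ ≤
      ENNReal.ofReal (1 / 2) * (sys.negEntropy u + sys.negEntropy v) := by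
  unfold negEntropy
  rw [← lintegral_add_left' hu.aemeasurable_mulLogAddOne,
    ← lintegral_const_mul' _ _ ENNReal.ofReal_ne_top,
    ← lintegral_add_left' (hu.mix hv (by norm_num) (by norm_num)).aemeasurable_mulLogAddOne]
  apply lintegral_mono_ae
  filter_upwards [hu.ae_lt_top, hv.ae_lt_top] with x hx hy using mulLogAddOne_midpoint_add_le hx hy

omit [BorelSpace V] in
theorem isState_one : sys.IsState fun _ => 1 :=
  ⟨fun _ _ => one_pos, lowerSemicontinuous_const.lowerSemicontinuousOn _, by simp, by simp⟩

omit [BorelSpace V] in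
theorem negEntropy_one : sys.negEntropy (fun _ => 1) = sys.μ univ := by
  simp [negEntropy, mulLogAddOne]

theorem IsState.le_negEntropy (hu : sys.IsState u) : sys.μ univ ≤ sys.negEntropy u := by
  rw [← hu.2.2.2]
  apply lintegral_mono_ae
  filter_upwards [hu.ae_lt_top] with x hx using le_mulLogAddOne hx

theorem IsState.ae_eq_one (hu : sys.IsState u) (h : sys.negEntropy u ≤ sys.μ univ) :
    ∀ᵐ x ∂sys.μ, u x = 1 := by
  have h1 : u =ᵐ[sys.μ] fun x => mulLogAddOne (u x) := by
    refine ae_eq_of_ae_le_of_lintegral_le ?_ ?_ hu.aemeasurable_mulLogAddOne ?_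
    · filter_upwards [hu.ae_lt_top] with x hx using le_mulLogAddOne hx
    · rw [hu.2.2.2]; exact sys.μ_univ_ne_top
    · rw [hu.2.2.2]; exact h
  filter_upwards [h1] with x hx using eq_one_of_mulLogAddOne_eq hx

/-- The shift by `1` makes the integrand non-negative, so entropy can be handled by lower Lebesgue
integrals; the value `⊥` corresponds to an infinite one. -/
theorem IsState.entropy_eq (hu : sys.IsState u) :
    sys.entropy u = 1 - ((sys.negEntropy u / sys.μ univ : ℝ≥0∞) : EReal) := by
  have hm0 := sys.μ_univ_ne_zero
  have hmt := sys.μ_univ_ne_top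
  have hmeas : AEStronglyMeasurable
      (fun x => (u x).toReal * Real.log (u x).toReal + 1) sys.μ :=
    ((by fun_prop : Measurable fun a : ℝ≥0∞ =>
      a.toReal * Real.log a.toReal + 1).comp_aemeasurable hu.aemeasurable_μ).aestronglyMeasurable
  have hnn : 0 ≤ᵐ[sys.μ] fun x => (u x).toReal * Real.log (u x).toReal + 1 :=
    ae_of_all _ fun x => mulLog_add_one_nonneg (u x).toReal_nonneg
  have hiff := lintegral_ofReal_ne_top_iff_integrable hmeas hnn
  unfold entropy
  split_ifs with hint
  · have hint1 := hint.add (integrable_const (μ := sys.μ) (1 : ℝ))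
    have hG : sys.negEntropy u = ENNReal.ofReal
        (∫ x, ((u x).toReal * Real.log (u x).toReal + 1) ∂sys.μ) :=
      (ofReal_integral_eq_lintegral_ofReal hint1 hnn).symm
    have hpos : 0 < sys.μ.real univ := ENNReal.toReal_pos hm0 hmt
    have hI : 0 ≤ ∫ x, ((u x).toReal * Real.log (u x).toReal + 1) ∂sys.μ :=
      integral_nonneg_of_ae hnn
    rw [hG, ← ENNReal.ofReal_toReal hmt,
      ← ENNReal.ofReal_div_of_pos (y := (sys.μ univ).toReal) hpos,
      EReal.coe_ennreal_ofReal, max_eq_left (by positivity), integral_add hint (integrable_const _)]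
    rw [← EReal.coe_one, ← EReal.coe_sub]
    congr 1
    simp only [integral_const, smul_eq_mul, mul_one]
    change _ = 1 - (_ + sys.μ.real univ) / sys.μ.real univ
    field_simp
    ring
  · have hG : sys.negEntropy u = ∞ := by
      by_contra hne
      refine hint ?_
      have h2 := (hiff.1 hne).sub (integrable_const (μ := sys.μ) (1 : ℝ))
      exact h2.congr (ae_of_all _ fun x => by simp)
    rw [hG, ENNReal.top_div_of_ne_top hmt]
    simp

/-! ### Control of the entropy by the energy. -/

variable [FiniteDimensional ℝ V]

/-- The energy controls the entropy. -/
theorem exists_negEntropy_le [Nontrivial V] (sys : System V) :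
    ∃ C : ℝ≥0∞, C ≠ ∞ ∧ ∀ u, sys.IsState u →
      sys.negEntropy u ≤ C * (sys.σ univ + ∫⁻ x, u x ∂sys.σ) := by
  obtain ⟨x₀, hx₀⟩ := sys.isPolytope.2.1
  have hx₀P := interior_subset hx₀
  obtain ⟨δ, hδ, hball⟩ := Metric.mem_nhds_iff.1 (mem_interior_iff_mem_nhds.1 hx₀)
  obtain ⟨K', hK't, hK'⟩ := exists_state_le (sys := sys) hδ
  obtain ⟨C, hC, hseg⟩ := sys.exists_lintegral_le_lintegral_segments hx₀
  -- Raising the bounds at both ends of a segment to at least `1` gives `K ^ (1 - r) ≤ K` and `1 ≤ K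
  -- * b ^ r`, as `mulLog_le_mulLog` requires.
  set K : ℝ := max 1 K'.toReal with hK
  have hK1 : 1 ≤ K := le_max_left _ _
  have hlK := Real.log_nonneg hK1
  have hA : 0 < K * Real.log K + K + 1 := by positivity
  refine ⟨C * ENNReal.ofReal (K * Real.log K + K + 1),
    ENNReal.mul_ne_top hC ENNReal.ofReal_ne_top, fun u hu => ?_⟩
  have hu0 : (u x₀).toReal ≤ K :=
    (ENNReal.toReal_mono hK't (hK' u hu x₀ hball)).trans (le_max_right _ _)
  have hu0t : u x₀ ≠ ∞ := ((hK' u hu x₀ hball).trans_lt hK't.lt_top).ne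
  have hinner : ∀ y ∈ sys.P, ∫⁻ r in Ioo (0 : ℝ) 1,
      mulLogAddOne (sys.P.indicator u (AffineMap.lineMap x₀ y r)) ≤
        ENNReal.ofReal (K * Real.log K + K + 1) * (1 + u y) := by
    intro y hy
    by_cases hyt : u y = ∞
    · rw [hyt, add_top, ENNReal.mul_top (by simpa using hA)]
      exact le_top
    set b : ℝ := max 1 (u y).toReal with hb
    have hb1 : 1 ≤ b := le_max_left _ _
    have hb0 : 0 < b := by linarith
    calc ∫⁻ r in Ioo (0 : ℝ) 1, mulLogAddOne (sys.P.indicator u (AffineMap.lineMap x₀ y r))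
        ≤ ∫⁻ r in Ioo (0 : ℝ) 1, ENNReal.ofReal (K * b ^ r * Real.log (K * b ^ r) + 1) := by
          refine setLIntegral_mono' measurableSet_Ioo fun r hr => ?_
          have hz : (AffineMap.lineMap x₀ y r : V) ∈ sys.P :=
            sys.isPolytope.convex.lineMap_mem hx₀P hy ⟨hr.1.le, hr.2.le⟩
          have hr1 : 0 < 1 - r := by linarith [hr.2]
          have h1 := hu.logConvexOn x₀ hx₀P y hy r hr.1.le hr.2.le
          rw [← AffineMap.lineMap_apply_module] at h1
          have h2 : (u (AffineMap.lineMap x₀ y r)).toReal ≤ K * b ^ r := by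
            have h3 := ENNReal.toReal_mono (ENNReal.mul_ne_top
              (ENNReal.rpow_ne_top_of_nonneg hr1.le hu0t)
              (ENNReal.rpow_ne_top_of_nonneg hr.1.le hyt)) h1
            rw [ENNReal.toReal_mul, ← ENNReal.toReal_rpow, ← ENNReal.toReal_rpow] at h3
            refine h3.trans (mul_le_mul ?_ ?_ (by positivity) (by positivity))
            · refine (Real.rpow_le_rpow (by positivity) hu0 hr1.le).trans ?_
              simpa using Real.rpow_le_rpow_of_exponent_le hK1 (by linarith [hr.1] : 1 - r ≤ 1)
            · exact Real.rpow_le_rpow (by positivity) (le_max_right _ _) hr.1.le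
          rw [indicator_of_mem hz, mulLogAddOne]
          apply ENNReal.ofReal_le_ofReal
          have h4 : 1 ≤ K * b ^ r :=
            one_le_mul_of_one_le_of_one_le hK1 (Real.one_le_rpow hb1 hr.1.le)
          linarith [mulLog_le_mulLog ENNReal.toReal_nonneg h2 h4]
      _ ≤ ENNReal.ofReal ((K * Real.log K + K + 1) * b) := lintegral_mulLog_rpow_le hK1 hb1
      _ ≤ ENNReal.ofReal (K * Real.log K + K + 1) * (1 + u y) := by
          rw [ENNReal.ofReal_mul hA.le]
          gcongr
          rw [← ENNReal.ofReal_toReal hyt, ← ENNReal.ofReal_one,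
            ← ENNReal.ofReal_add zero_le_one ENNReal.toReal_nonneg]
          apply ENNReal.ofReal_le_ofReal
          exact max_le (by linarith [(u y).toReal_nonneg]) (by linarith)
  calc sys.negEntropy u = ∫⁻ z, mulLogAddOne (sys.P.indicator u z) ∂sys.μ := by
        refine lintegral_congr_ae ?_
        filter_upwards [sys.ae_μ_mem] with x hx
        rw [indicator_of_mem hx]
    _ ≤ C * ∫⁻ y, (∫⁻ r in Ioo (0 : ℝ) 1,
          mulLogAddOne (sys.P.indicator u (AffineMap.lineMap x₀ y r))) ∂sys.σ :=
        hseg _ (measurable_mulLogAddOne.comp hu.measurable_indicator)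
    _ ≤ C * ∫⁻ y, ENNReal.ofReal (K * Real.log K + K + 1) * (1 + u y) ∂sys.σ := by
        exact mul_le_mul_right (lintegral_mono_ae (sys.ae_σ_mem.mono hinner)) C
    _ = _ := by
        rw [lintegral_const_mul' _ _ ENNReal.ofReal_ne_top,
          lintegral_add_left' aemeasurable_const, lintegral_one, mul_assoc]

end System

/-! ### Regularity of states and their limits. -/

/-- A finite log convex function on an open set is continuous. -/
theorem LogConvexOn.continuousOn {V : Type*} [NormedAddCommGroup V] [NormedSpace ℝ V]
    [FiniteDimensional ℝ V] {O : Set V} (hO : IsOpen O) (hOc : Convex ℝ O) {w : V → ℝ≥0∞}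
    (hw : LogConvexOn O w) (hfin : ∀ x ∈ O, w x < ∞) : ContinuousOn w O := by
  have hconv : ConvexOn ℝ O fun x => (w x).toReal := by
    refine ⟨hOc, fun x hx y hy a b ha hb hab => ?_⟩
    obtain rfl : a = 1 - b := by linarith
    have h1 := hw.convex_le hx hy hb (by linarith)
    have h2 := ENNReal.mul_ne_top (ENNReal.ofReal_ne_top (r := 1 - b)) (hfin x hx).ne
    have h3 := ENNReal.mul_ne_top (ENNReal.ofReal_ne_top (r := b)) (hfin y hy).ne
    have h4 := ENNReal.toReal_mono (ENNReal.add_ne_top.2 ⟨h2, h3⟩) h1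
    rwa [ENNReal.toReal_add h2 h3, ENNReal.toReal_mul, ENNReal.toReal_mul,
      ENNReal.toReal_ofReal ha, ENNReal.toReal_ofReal hb] at h4
  have h1 : ContinuousOn (fun x => ENNReal.ofReal (w x).toReal) O :=
    ENNReal.continuous_ofReal.comp_continuousOn (hconv.continuousOn hO)
  exact h1.congr fun x hx => (ENNReal.ofReal_toReal (hfin x hx).ne).symm

namespace System

variable {V : Type*} [NormedAddCommGroup V] [NormedSpace ℝ V] [FiniteDimensional ℝ V]
  [MeasurableSpace V] [BorelSpace V] {sys : System V} {v : ℕ → V → ℝ≥0∞}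

theorem exists_state_le_of_mem_interior {x : V} (hx : x ∈ interior sys.P) :
    ∃ K : ℝ≥0∞, K ≠ ∞ ∧ ∀ u, sys.IsState u → u x ≤ K := by
  obtain ⟨δ, hδ, hball⟩ := Metric.mem_nhds_iff.1 (mem_interior_iff_mem_nhds.1 hx)
  obtain ⟨K, hK, h⟩ := exists_state_le (sys := sys) hδ
  exact ⟨K, hK, fun u hu => h u hu x hball⟩

theorem limsup_state_lt_top (hv : ∀ n, sys.IsState (v n)) {x : V} (hx : x ∈ interior sys.P) :
    limsup (fun n => v n x) atTop < ∞ := by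
  obtain ⟨K, hK, h⟩ := exists_state_le_of_mem_interior hx
  exact (limsup_le_of_le (by isBoundedDefault) (Eventually.of_forall fun n => h _ (hv n))).trans_lt
    hK.lt_top

/-- Upper limits commute with powers and are submultiplicative unless `0 * ∞` occurs; their
finiteness at interior points excludes that. -/
theorem logConvexOn_limsup (hv : ∀ n, sys.IsState (v n)) :
    LogConvexOn (interior sys.P) fun x => limsup (fun n => v n x) atTop := by
  intro x hx y hy t h0 h1
  have hpow : ∀ (a : ℕ → ℝ≥0∞) (s : ℝ), 0 ≤ s →
      (limsup a atTop) ^ s = limsup (fun n => a n ^ s) atTop := fun a s hs =>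
    (ENNReal.monotone_rpow_of_nonneg hs).map_limsup_of_continuousAt a
      ENNReal.continuous_rpow_const.continuousAt
  have hx' := limsup_state_lt_top hv hx
  have hy' := limsup_state_lt_top hv hy
  have h1' : 0 ≤ 1 - t := by linarith
  calc limsup (fun n => v n ((1 - t) • x + t • y)) atTop
      ≤ limsup ((fun n => v n x ^ (1 - t)) * fun n => v n y ^ t) atTop :=
        limsup_le_limsup (Eventually.of_forall fun n => (hv n).logConvexOn x
          (interior_subset hx) y (interior_subset hy) t h0 h1)
    _ ≤ limsup (fun n => v n x ^ (1 - t)) atTop * limsup (fun n => v n y ^ t) atTop := by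
        refine ENNReal.limsup_mul_le' (Or.inr ?_) (Or.inl ?_)
        · rw [← hpow _ _ h0]; exact ENNReal.rpow_ne_top_of_nonneg h0 hy'.ne
        · rw [← hpow _ _ h1']; exact ENNReal.rpow_ne_top_of_nonneg h1' hx'.ne
    _ = _ := by rw [← hpow _ _ h0, ← hpow _ _ h1']

theorem continuousOn_limsup (hv : ∀ n, sys.IsState (v n)) :
    ContinuousOn (fun x => limsup (fun n => v n x) atTop) (interior sys.P) :=
  (logConvexOn_limsup hv).continuousOn isOpen_interior sys.isPolytope.convex.interior
    fun _ hx => limsup_state_lt_top hv hx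

omit [FiniteDimensional ℝ V] [BorelSpace V] in
/-- Continuous functions that agree almost everywhere on the polytope agree inside it. -/
theorem eqOn_interior_of_ae_eq {f g : V → ℝ≥0∞} (h : f =ᵐ[sys.μ] g)
    (hf : ContinuousOn f (interior sys.P)) (hg : ContinuousOn g (interior sys.P)) :
    EqOn f g (interior sys.P) := by
  obtain ⟨ν, hν, hμ⟩ := sys.μ_flat
  rw [hμ] at h
  exact Measure.eqOn_open_of_ae_eq (ae_restrict_of_ae_restrict_of_subset interior_subset h)
    isOpen_interior hf hg

/-- Almost everywhere convergent states converge everywhere inside the polytope. -/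
theorem tendsto_limsup_of_ae_tendsto (hv : ∀ n, sys.IsState (v n)) {g : V → ℝ≥0∞}
    (hg : ∀ᵐ x ∂sys.μ, Tendsto (fun n => v n x) atTop (𝓝 (g x))) {x : V}
    (hx : x ∈ interior sys.P) :
    Tendsto (fun n => v n x) atTop (𝓝 (limsup (fun n => v n x) atTop)) := by
  -- Along a subsequence realizing the lower limit at `x`, the upper limit is again continuous
  -- inside `P` and equals the full one almost everywhere, hence also at `x`.
  obtain ⟨φ, hlim, hφ⟩ := exists_seq_tendsto_liminf (f := atTop) (u := fun n => v n x)
  have hae : (fun x => limsup (fun n => v (φ n) x) atTop) =ᵐ[sys.μ]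
      fun x => limsup (fun n => v n x) atTop := by
    filter_upwards [hg] with y hy
    rw [hy.limsup_eq]
    exact (hy.comp hφ).limsup_eq
  have heq := eqOn_interior_of_ae_eq hae (continuousOn_limsup fun n => hv (φ n))
    (continuousOn_limsup hv) hx
  refine tendsto_of_le_liminf_of_limsup_le ?_ le_rfl
  exact heq.symm.le.trans hlim.limsup_eq.le

/-- Only `y` may be a boundary point, where convergence is not known. Pass to a subsequence
realizing the lower limit there; at the other two points the whole sequence converges. -/
theorem limsup_segment_le (hv : ∀ n, sys.IsState (v n)) {g : V → ℝ≥0∞}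
    (hg : ∀ᵐ x ∂sys.μ, Tendsto (fun n => v n x) atTop (𝓝 (g x))) {x y : V}
    (hx : x ∈ interior sys.P) (hy : y ∈ sys.P) {t : ℝ} (h0 : 0 ≤ t) (h1 : t < 1) :
    limsup (fun n => v n ((1 - t) • x + t • y)) atTop ≤
      ENNReal.ofReal (1 - t) * limsup (fun n => v n x) atTop +
        ENNReal.ofReal t * liminf (fun n => v n y) atTop := by
  have hz : (1 - t) • x + t • y ∈ interior sys.P :=
    sys.isPolytope.convex.combo_interior_self_mem_interior hx hy (by linarith) h0 (by ring)
  obtain ⟨φ, hlim, hφ⟩ := exists_seq_tendsto_liminf (f := atTop) (u := fun n => v n y)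
  refine le_of_tendsto_of_tendsto' ((tendsto_limsup_of_ae_tendsto hv hg hz).comp hφ)
    ((ENNReal.Tendsto.const_mul ((tendsto_limsup_of_ae_tendsto hv hg hx).comp hφ)
      (Or.inr ENNReal.ofReal_ne_top)).add
    (ENNReal.Tendsto.const_mul hlim (Or.inr ENNReal.ofReal_ne_top))) fun n => ?_
  exact (hv (φ n)).logConvexOn.convex_le (interior_subset hx) hy h0 h1.le

/-- An upper limit of states which is positive at some interior point is bounded below by a
positive constant inside the polytope. -/
theorem exists_pos_le_limsup (hv : ∀ n, sys.IsState (v n)) {x₁ : V} (hx₁ : x₁ ∈ interior sys.P)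
    (hpos : limsup (fun n => v n x₁) atTop ≠ 0) :
    ∃ c : ℝ≥0∞, 0 < c ∧ ∀ z ∈ interior sys.P, c ≤ limsup (fun n => v n z) atTop := by
  obtain ⟨δ, hδ, hball⟩ := Metric.mem_nhds_iff.1 (mem_interior_iff_mem_nhds.1 hx₁)
  obtain ⟨K, hKt, hK⟩ := exists_state_le (sys := sys) (half_pos hδ)
  obtain ⟨D, hD⟩ := sys.isPolytope.1.isBounded.subset_closedBall x₁
  have hD0 : 0 ≤ D := dist_nonneg.trans (hD (interior_subset hx₁))
  -- The segment from `z` through `x₁` is prolonged to `z'`, with `e` small enough to keep `z'`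
  -- within `δ / 2` of `x₁`, where `K` bounds the states. Log convexity gives `W x₁ ≤ W z ^ (1 - t)
  -- * K ^ t`, a lower bound for `W z`.
  set e : ℝ := δ / 2 / (D + 1) with he
  have he0 : 0 < e := by positivity
  set t : ℝ := 1 / (1 + e) with ht
  have ht0 : 0 < t := by positivity
  have ht1 : t < 1 := by rw [ht, div_lt_one (by positivity)]; linarith
  have ht1' : 0 < 1 - t := by linarith
  set W : V → ℝ≥0∞ := fun z => limsup (fun n => v n z) atTop with hW
  have hKpow : K ^ t ≠ ∞ := ENNReal.rpow_ne_top_of_nonneg ht0.le hKt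
  refine ⟨(W x₁ / K ^ t) ^ (1 - t)⁻¹, ENNReal.rpow_pos_of_nonneg (ENNReal.div_pos hpos hKpow)
    (by positivity), fun z hz => ?_⟩
  have hzD : ‖x₁ - z‖ ≤ D := by
    have := hD (interior_subset hz)
    rwa [Metric.mem_closedBall, dist_comm, dist_eq_norm] at this
  set z' : V := x₁ + e • (x₁ - z) with hz'
  have hsmall : ‖e • (x₁ - z)‖ < δ / 2 := by
    rw [norm_smul, Real.norm_of_nonneg he0.le]
    calc e * ‖x₁ - z‖ ≤ e * D := by gcongr
      _ < e * (D + 1) := by gcongr; linarith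
      _ = δ / 2 := by rw [he]; field_simp
  have hz'ball : Metric.ball z' (δ / 2) ⊆ Metric.ball x₁ δ := by
    refine Metric.ball_subset_ball' ?_
    have : dist z' x₁ < δ / 2 := by rwa [hz', dist_eq_norm, add_sub_cancel_left]
    linarith
  have hz'int : z' ∈ interior sys.P := mem_interior.2
    ⟨_, hz'ball.trans hball, Metric.isOpen_ball, Metric.mem_ball_self (half_pos hδ)⟩
  have hz'K : W z' ≤ K := limsup_le_of_le (by isBoundedDefault)
    (Eventually.of_forall fun n => hK _ (hv n) z' (hz'ball.trans hball))
  have hcomb : (1 - t) • z + t • z' = x₁ := by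
    have h1 : t * (1 + e) = 1 := by rw [ht]; field_simp
    have h2 : (1 - t) • z + t • z' = (1 - t * (1 + e)) • z + (t * (1 + e)) • x₁ := by
      rw [hz']; module
    rw [h2, h1]; simp
  have hlc := logConvexOn_limsup hv z hz z' hz'int t ht0.le ht1.le
  rw [hcomb] at hlc
  rw [ENNReal.rpow_inv_le_iff ht1']
  refine ENNReal.div_le_of_le_mul (hlc.trans ?_)
  exact mul_le_mul_right (ENNReal.rpow_le_rpow hz'K ht0.le) _

/-- Almost everywhere limits of states, without loss of mass, are states after a modification on a
null set, and the modification is bounded by the lower limits at all points. -/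
theorem exists_state_of_ae_tendsto (hv : ∀ n, sys.IsState (v n)) {g : V → ℝ≥0∞}
    (hg : ∀ᵐ x ∂sys.μ, Tendsto (fun n => v n x) atTop (𝓝 (g x)))
    (hgi : ∫⁻ x, g x ∂sys.μ = sys.μ univ) :
    ∃ u, sys.IsState u ∧ u =ᵐ[sys.μ] g ∧
      ∀ y ∈ sys.P, u y ≤ liminf (fun n => v n y) atTop := by
  set W : V → ℝ≥0∞ := fun z => limsup (fun n => v n z) atTop with hW
  set I := interior sys.P with hI
  have hconv := sys.isPolytope.convex
  have hWg : W =ᵐ[sys.μ] g := hg.mono fun x hx => hx.limsup_eq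
  have hWc : ContinuousOn W I := continuousOn_limsup hv
  have hclosure : ∀ y ∈ sys.P, y ∈ closure I := fun y hy => by
    rw [hI, hconv.closure_interior_eq_closure_of_nonempty_interior sys.isPolytope.2.1]
    exact subset_closure hy
  obtain ⟨x₁, hx₁, hx₁0⟩ : ∃ x₁ ∈ I, W x₁ ≠ 0 := by
    by_contra! hcon
    have h1 : ∫⁻ x, g x ∂sys.μ = 0 := by
      rw [← lintegral_congr_ae hWg]
      have : W =ᵐ[sys.μ] fun _ => 0 := sys.ae_μ_mem_interior.mono hcon
      rw [lintegral_congr_ae this, lintegral_zero]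
    exact sys.μ_univ_ne_zero (hgi ▸ h1)
  obtain ⟨c, hc0, hc⟩ := exists_pos_le_limsup hv hx₁ hx₁0
  -- Boundary values are read off from inside: this is the lower semi-continuous extension of the
  -- interior limit.
  set u : V → ℝ≥0∞ := fun y => liminf W (𝓝[I] y) with hu
  have huW : ∀ x ∈ I, u x = W x := fun x hx => by
    have : (𝓝[I] x).NeBot := mem_closure_iff_nhdsWithin_neBot.1 (subset_closure hx)
    exact (hWc x hx).tendsto.liminf_eq
  have huc : ∀ y, c ≤ u y := fun y =>
    le_liminf_of_le (by isBoundedDefault) (eventually_mem_nhdsWithin.mono hc)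
  have hu0 : ∀ y, 0 < u y := fun y => hc0.trans_le (huc y)
  have hug : u =ᵐ[sys.μ] g := by
    filter_upwards [sys.ae_μ_mem_interior, hWg] with x hx hx'
    rw [huW x hx, hx']
  refine ⟨u, ⟨fun x _ => hu0 x, ?_, ?_, ?_⟩, hug, ?_⟩
  · intro x _ a ha
    obtain ⟨b, hab, hb⟩ := exists_between ha
    obtain ⟨O, hO, hxO, hsub⟩ := mem_nhdsWithin.1 (eventually_lt_of_lt_liminf hb)
    filter_upwards [mem_nhdsWithin_of_mem_nhds (hO.mem_nhds hxO)] with y hy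
    refine hab.trans_le (le_liminf_of_le (by isBoundedDefault) ?_)
    refine mem_of_superset (mem_nhdsWithin.2 ⟨O, hO, hy, subset_rfl⟩) fun z hz => ?_
    exact (show b < W z from hsub hz).le
  · intro x hx y hy t h0 h1
    rcases h0.eq_or_lt with rfl | h0
    · simp
    rcases h1.eq_or_lt with rfl | h1
    · simp
    have h1' : 0 < 1 - t := by linarith
    -- There are interior points arbitrarily near `x` and `y` with `W` below the two thresholds;
    -- their combinations approach the target point. Positivity of `u` excludes `0 * ∞`.
    refine ENNReal.le_mul_of_forall_lt (Or.inl (ENNReal.rpow_pos_of_nonneg (hu0 x) h1'.le).ne')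
      (Or.inr (ENNReal.rpow_pos_of_nonneg (hu0 y) h0.le).ne') fun a ha b hb => ?_
    have ha' : u x < a ^ (1 - t)⁻¹ := (ENNReal.lt_rpow_inv_iff h1').2 ha
    have hb' : u y < b ^ t⁻¹ := (ENNReal.lt_rpow_inv_iff h0).2 hb
    have hfx := frequently_lt_of_liminf_lt (by isBoundedDefault) ha'
    have hfy := frequently_lt_of_liminf_lt (by isBoundedDefault) hb'
    have hfreq := frequently_prod_and.2 ⟨hfx.and_eventually eventually_mem_nhdsWithin,
      hfy.and_eventually eventually_mem_nhdsWithin⟩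
    have htend : Tendsto (fun p : V × V => (1 - t) • p.1 + t • p.2) (𝓝[I] x ×ˢ 𝓝[I] y)
        (𝓝[I] ((1 - t) • x + t • y)) := by
      rw [← nhdsWithin_prod_eq]
      refine tendsto_nhdsWithin_iff.2 ⟨?_, ?_⟩
      · refine (Continuous.tendsto' ?_ _ _ rfl).mono_left nhdsWithin_le_nhds
        fun_prop
      · filter_upwards [self_mem_nhdsWithin] with p hp
        exact hconv.interior hp.1 hp.2 h1'.le h0.le (by ring)
    refine liminf_le_of_frequently_le' (htend.frequently (hfreq.mono fun p hp => ?_))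
    refine (logConvexOn_limsup hv p.1 hp.1.2 p.2 hp.2.2 t h0.le h1.le).trans (mul_le_mul' ?_ ?_)
    · exact ((ENNReal.lt_rpow_inv_iff h1').1 hp.1.1).le
    · exact ((ENNReal.lt_rpow_inv_iff h0).1 hp.2.1).le
  · rw [lintegral_congr_ae hug, hgi]
  · intro y hy
    have hpath : Tendsto (fun t : ℝ => (1 - t) • x₁ + t • y) (𝓝[<] 1) (𝓝[I] y) := by
      refine tendsto_nhdsWithin_iff.2 ⟨?_, ?_⟩
      · refine (Continuous.tendsto' ?_ _ _ (by simp)).mono_left nhdsWithin_le_nhds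
        fun_prop
      · filter_upwards [Ioo_mem_nhdsLT (zero_lt_one : (0 : ℝ) < 1)] with t ht
        exact hconv.combo_interior_self_mem_interior hx₁ hy (by linarith [ht.2]) ht.1.le (by ring)
    have hlim : Tendsto (fun t : ℝ => ENNReal.ofReal (1 - t) * W x₁ +
        ENNReal.ofReal t * liminf (fun n => v n y) atTop) (𝓝[<] 1)
        (𝓝 (liminf (fun n => v n y) atTop)) := by
      have hA : Tendsto (fun t : ℝ => ENNReal.ofReal (1 - t)) (𝓝[<] 1) (𝓝 0) := by
        refine (Continuous.tendsto' ?_ _ _ (by simp)).mono_left nhdsWithin_le_nhds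
        exact ENNReal.continuous_ofReal.comp (by fun_prop)
      have hB : Tendsto (fun t : ℝ => ENNReal.ofReal t) (𝓝[<] 1) (𝓝 1) := by
        refine (Continuous.tendsto' ?_ _ _ (by simp)).mono_left nhdsWithin_le_nhds
        exact ENNReal.continuous_ofReal
      simpa using (ENNReal.Tendsto.mul_const hA (Or.inr (limsup_state_lt_top hv hx₁).ne)).add
        (ENNReal.Tendsto.mul_const hB (Or.inl one_ne_zero))
    calc u y ≤ liminf W (map (fun t : ℝ => (1 - t) • x₁ + t • y) (𝓝[<] 1)) :=
          liminf_le_liminf_of_le hpath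
      _ = liminf (fun t : ℝ => W ((1 - t) • x₁ + t • y)) (𝓝[<] 1) := rfl
      _ ≤ liminf (fun t : ℝ => ENNReal.ofReal (1 - t) * W x₁ +
            ENNReal.ofReal t * liminf (fun n => v n y) atTop) (𝓝[<] 1) := by
          refine liminf_le_liminf ?_
          filter_upwards [Ioo_mem_nhdsLT (zero_lt_one : (0 : ℝ) < 1)] with t ht
          exact limsup_segment_le hv hg hx₁ hy ht.1.le ht.2
      _ = liminf (fun n => v n y) atTop := hlim.liminf_eq

/-- A state of entropy zero has at least the energy of the constant state. -/
theorem IsState.lintegral_σ_one_le {u : V → ℝ≥0∞} (hu : sys.IsState u)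
    (h : sys.negEntropy u ≤ sys.μ univ) : sys.σ univ ≤ ∫⁻ x, u x ∂sys.σ := by
  have hc : ContinuousOn u (interior sys.P) := by
    refine LogConvexOn.continuousOn isOpen_interior sys.isPolytope.convex.interior
      (fun x hx y hy => hu.logConvexOn x (interior_subset hx) y (interior_subset hy))
      fun x hx => ?_
    obtain ⟨K, hK, hle⟩ := exists_state_le_of_mem_interior hx
    exact (hle u hu).trans_lt hK.lt_top
  have h1 : EqOn u (fun _ => 1) (interior sys.P) :=
    eqOn_interior_of_ae_eq (hu.ae_eq_one h) hc continuousOn_const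
  obtain ⟨x₀, hx₀⟩ := sys.isPolytope.2.1
  -- Lower semi-continuity only bounds boundary values from above; the lower bound is log convexity
  -- at the midpoint of `x₀` and `y`, where `u = 1`.
  have h2 : ∀ y ∈ sys.P, 1 ≤ u y := by
    intro y hy
    have hz := sys.isPolytope.convex.combo_interior_self_mem_interior hx₀ hy
      (a := 1 - 1 / 2) (b := 1 / 2) (by norm_num) (by norm_num) (by norm_num)
    have h3 := hu.logConvexOn x₀ (interior_subset hx₀) y hy (1 / 2) (by norm_num) (by norm_num)
    rw [h1 hz, h1 hx₀, ENNReal.one_rpow, one_mul] at h3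
    by_contra hlt
    exact absurd (ENNReal.rpow_lt_one (not_le.1 hlt) (by norm_num : (0 : ℝ) < 1 / 2))
      (not_lt.2 h3)
  calc sys.σ univ = ∫⁻ _, 1 ∂sys.σ := lintegral_one.symm
    _ ≤ ∫⁻ x, u x ∂sys.σ := lintegral_mono_ae (sys.ae_σ_mem.mono h2)

end System

/-! ### Existence of states of largest entropy at bounded energy. -/

theorem eLpNorm_two_eq_lintegral_ofReal_sq {α : Type*} [MeasurableSpace α] (μ : Measure α)
    (f : α → ℝ) : eLpNorm f 2 μ = (∫⁻ x, ENNReal.ofReal (f x ^ 2) ∂μ) ^ (1 / 2 : ℝ) := by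
  rw [eLpNorm_eq_lintegral_rpow_enorm_toReal two_ne_zero ENNReal.ofNat_ne_top]
  simp only [ENNReal.toReal_ofNat]
  congr 1
  refine lintegral_congr fun x => ?_
  rw [← ofReal_norm, ENNReal.ofReal_rpow_of_nonneg (norm_nonneg _) zero_le_two]
  simp

namespace System

variable {V : Type*} [NormedAddCommGroup V] [NormedSpace ℝ V]
  [MeasurableSpace V] [BorelSpace V] {sys : System V} {v : ℕ → V → ℝ≥0∞}

theorem IsState.lintegral_sqrt_sq {u : V → ℝ≥0∞} (hu : sys.IsState u) :
    ∫⁻ x, ENNReal.ofReal (√(u x).toReal ^ 2) ∂sys.μ = sys.μ univ := by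
  rw [← hu.2.2.2]
  refine lintegral_congr_ae ?_
  filter_upwards [hu.ae_lt_top] with x hx
  rw [Real.sq_sqrt ENNReal.toReal_nonneg, ENNReal.ofReal_toReal hx.ne]

theorem IsState.memLp_sqrt {u : V → ℝ≥0∞} (hu : sys.IsState u) :
    MemLp (fun x => √(u x).toReal) 2 sys.μ := by
  refine ⟨((by fun_prop : Measurable fun a : ℝ≥0∞ => √a.toReal).comp_aemeasurable
    hu.aemeasurable_μ).aestronglyMeasurable, ?_⟩
  rw [eLpNorm_two_eq_lintegral_ofReal_sq, hu.lintegral_sqrt_sq]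
  exact ENNReal.rpow_lt_top_of_nonneg (by norm_num) sys.μ_univ_ne_top

/-- A sequence of states whose square roots form a Cauchy sequence in `L²` has a subsequence that
converges almost everywhere, without loss of mass. -/
theorem exists_subseq_ae_tendsto (hv : ∀ n, sys.IsState (v n)) {η : ℕ → ℝ≥0∞}
    (hη : Tendsto η atTop (𝓝 0))
    (hcauchy : ∀ N m n, N ≤ m → N ≤ n →
      ∫⁻ x, ENNReal.ofReal ((√(v m x).toReal - √(v n x).toReal) ^ 2 / 4) ∂sys.μ ≤ η N) :
    ∃ (φ : ℕ → ℕ) (g : V → ℝ≥0∞), StrictMono φ ∧ (∀ x, g x < ∞) ∧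
      (∀ᵐ x ∂sys.μ, Tendsto (fun n => v (φ n) x) atTop (𝓝 (g x))) ∧
      ∫⁻ x, g x ∂sys.μ = sys.μ univ := by
  have hmem := fun n => (hv n).memLp_sqrt
  set F : ℕ → Lp ℝ 2 sys.μ := fun n => (hmem n).toLp with hF
  have hη' : Tendsto (fun N => (4 * η N) ^ (1 / 2 : ℝ)) atTop (𝓝 0) := by
    have h1 : Tendsto (fun N => 4 * η N) atTop (𝓝 0) := by
      simpa using ENNReal.Tendsto.const_mul hη (Or.inr (ENNReal.ofNat_ne_top (n := 4)))
    have h2 := (ENNReal.continuous_rpow_const (y := (1 / 2 : ℝ))).tendsto 0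
    rw [ENNReal.zero_rpow_of_pos (by norm_num)] at h2
    exact h2.comp h1
  have hdist : ∀ N m n, N ≤ m → N ≤ n → edist (F m) (F n) ≤ (4 * η N) ^ (1 / 2 : ℝ) := by
    intro N m n hm hn
    rw [hF, Lp.edist_toLp_toLp, eLpNorm_two_eq_lintegral_ofReal_sq]
    refine ENNReal.rpow_le_rpow ?_ (by norm_num)
    calc ∫⁻ x, ENNReal.ofReal (((fun x => √(v m x).toReal) - fun x => √(v n x).toReal) x ^ 2) ∂sys.μ
        = 4 * ∫⁻ x, ENNReal.ofReal ((√(v m x).toReal - √(v n x).toReal) ^ 2 / 4) ∂sys.μ := by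
          rw [← lintegral_const_mul' _ _ ENNReal.ofNat_ne_top]
          refine lintegral_congr fun x => ?_
          rw [show (4 : ℝ≥0∞) = ENNReal.ofReal 4 by simp, ← ENNReal.ofReal_mul (by norm_num)]
          congr 1
          simp only [Pi.sub_apply]
          ring
      _ ≤ 4 * η N := mul_le_mul_right (hcauchy N m n hm hn) _
  have hC : CauchySeq F := by
    rw [EMetric.cauchySeq_iff]
    intro ε hε
    obtain ⟨N, hN⟩ := ((hη'.eventually (gt_mem_nhds hε)).exists)
    exact ⟨N, fun m hm n hn => (hdist N m n hm hn).trans_lt hN⟩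
  obtain ⟨L, hL⟩ := cauchySeq_tendsto_of_complete hC
  obtain ⟨φ, hφ, hae⟩ := (tendstoInMeasure_of_tendsto_Lp hL).exists_seq_tendsto_ae
  refine ⟨φ, fun x => ENNReal.ofReal (L x ^ 2), hφ, fun x => ENNReal.ofReal_lt_top, ?_, ?_⟩
  · have h1 : ∀ᵐ x ∂sys.μ, ∀ n, F n x = √(v n x).toReal :=
      ae_all_iff.2 fun n => (hmem n).coeFn_toLp
    have h2 : ∀ᵐ x ∂sys.μ, ∀ n, v n x < ∞ := ae_all_iff.2 fun n => (hv n).ae_lt_top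
    filter_upwards [hae, h1, h2] with x hx hx1 hx2
    have h3 := ENNReal.tendsto_ofReal (hx.pow 2)
    refine h3.congr fun n => ?_
    rw [hx1, Real.sq_sqrt ENNReal.toReal_nonneg, ENNReal.ofReal_toReal (hx2 _).ne]
  -- All square roots of states have the same `L²` norm, which passes to the strong limit.
  · have h1 : Tendsto (fun n => ‖F n‖ₑ) atTop (𝓝 ‖L‖ₑ) := hL.enorm
    have h2 : ∀ n, ‖F n‖ₑ = sys.μ univ ^ (1 / 2 : ℝ) := by
      intro n
      rw [hF, Lp.enorm_toLp, eLpNorm_two_eq_lintegral_ofReal_sq, (hv n).lintegral_sqrt_sq]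
    have h3 := tendsto_nhds_unique h1 (by simp only [h2]; exact tendsto_const_nhds)
    rw [Lp.enorm_def, eLpNorm_two_eq_lintegral_ofReal_sq] at h3
    exact (ENNReal.rpow_left_injective (by norm_num : (1 / 2 : ℝ) ≠ 0)) h3

variable [FiniteDimensional ℝ V]

/-- Among the states of energy at most `c` there is one of largest entropy. -/
theorem exists_max_entropy [Nontrivial V] {c : ℝ≥0∞} (hc : c ≠ ∞)
    (hinf : ⨅ (u : V → ℝ≥0∞) (_ : sys.IsState u), ∫⁻ x, u x ∂sys.σ ≤ c) :
    ∃ u, sys.IsState u ∧ ∫⁻ x, u x ∂sys.σ ≤ c ∧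
      ∀ v, sys.IsState v → ∫⁻ x, v x ∂sys.σ ≤ c → sys.negEntropy u ≤ sys.negEntropy v := by
  obtain ⟨C, hC, hCle⟩ := exists_negEntropy_le sys
  set ε : ℕ → ℝ≥0∞ := fun k => ((k : ℝ≥0∞) + 1)⁻¹ with hε
  have hε_anti : Antitone ε := fun i j hij => by
    simp only [hε]
    gcongr
  have hε_pos : ∀ k, 0 < ε k := fun k => by simp [hε]
  have hε_lim : Tendsto ε atTop (𝓝 0) := by
    have := ENNReal.tendsto_inv_nat_nhds_zero.comp (tendsto_add_atTop_nat 1)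
    refine this.congr fun n => ?_
    simp [hε]
  have hε_le : ∀ k, ε k ≤ 1 := fun k => by
    simp [hε]
  -- The energy bound is relaxed by `ε k` because `c` may equal the infimum of the energy, not yet
  -- known to be attained.
  set A : ℕ → Set (V → ℝ≥0∞) := fun k =>
    {u | sys.IsState u ∧ ∫⁻ x, u x ∂sys.σ ≤ c + ε k} with hA
  set g : ℕ → ℝ≥0∞ := fun k => ⨅ u ∈ A k, sys.negEntropy u with hg
  have hAne : ∀ k, ∃ u, u ∈ A k := by
    intro k
    have h1 : ⨅ (u : V → ℝ≥0∞) (_ : sys.IsState u), ∫⁻ x, u x ∂sys.σ < c + ε k :=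
      hinf.trans_lt (ENNReal.lt_add_right hc (hε_pos k).ne')
    simp only [iInf_lt_iff] at h1
    obtain ⟨u, hu, hlt⟩ := h1
    exact ⟨u, hu, hlt.le⟩
  set M : ℝ≥0∞ := C * (sys.σ univ + (c + 1)) with hM
  have hMt : M ≠ ∞ := ENNReal.mul_ne_top hC (ENNReal.add_ne_top.2
    ⟨sys.σ_univ_lt_top.ne, ENNReal.add_ne_top.2 ⟨hc, ENNReal.one_ne_top⟩⟩)
  have hgM : ∀ k, g k ≤ M := by
    intro k
    obtain ⟨u, hu⟩ := hAne k
    refine (iInf₂_le u hu).trans ((hCle u hu.1).trans ?_)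
    exact mul_le_mul_right (add_le_add_right (hu.2.trans (add_le_add_right (hε_le k) _)) _) _
  set G : ℝ≥0∞ := ⨆ k, g k with hG
  have hGt : G ≠ ∞ := ((iSup_le hgM).trans_lt hMt.lt_top).ne
  have hg_mono : Monotone g := fun i j hij => by
    refine le_iInf₂ fun u hu => iInf₂_le u ⟨hu.1, hu.2.trans ?_⟩
    exact add_le_add_right (hε_anti hij) _
  have hg_lim : Tendsto g atTop (𝓝 G) := tendsto_atTop_iSup hg_mono
  have hex : ∀ k, ∃ u ∈ A k, sys.negEntropy u ≤ g k + ε k := by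
    intro k
    have h1 : g k < g k + ε k :=
      ENNReal.lt_add_right ((hgM k).trans_lt hMt.lt_top).ne (hε_pos k).ne'
    conv_lhs at h1 => rw [hg]
    simp only [iInf_lt_iff] at h1
    obtain ⟨u, hu, hlt⟩ := h1
    exact ⟨u, hu, hlt.le⟩
  choose v hvA hvG using hex
  have hv : ∀ n, sys.IsState (v n) := fun n => (hvA n).1
  have hvG' : ∀ n, sys.negEntropy (v n) ≤ G + ε n := fun n =>
    (hvG n).trans (add_le_add_left (le_iSup g n) _)
  have hhalf : ENNReal.ofReal (1 - 1 / 2) + ENNReal.ofReal (1 / 2) = 1 := by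
    rw [← ENNReal.ofReal_add (by norm_num) (by norm_num)]; norm_num
  have hhalf' : ∀ a : ℝ≥0∞, ENNReal.ofReal (1 / 2) * (a + a) = a := fun a => by
    rw [← two_mul, ← mul_assoc, show (2 : ℝ≥0∞) = ENNReal.ofReal 2 by simp,
      ← ENNReal.ofReal_mul (by norm_num)]
    norm_num
  -- For `m, n ≥ N` the midpoint of `v m` and `v n` lies in `A N`, so its negative entropy is at
  -- least `g N`. Uniform convexity bounds the gap by `G + ε N - g N`, which tends to zero.
  obtain ⟨φ, w, hφ, hwt, hae, hint⟩ := exists_subseq_ae_tendsto hv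
    (η := fun N => G + ε N - g N) (by
      have h1 : Tendsto (fun N => G + ε N) atTop (𝓝 G) := by
        simpa using tendsto_const_nhds.add hε_lim
      simpa using ENNReal.Tendsto.sub h1 hg_lim (Or.inl hGt)) (by
      intro N m n hm hn
      have hmid : NAThermo.mix (1 / 2) (v m) (v n) ∈ A N := by
        refine ⟨(hv m).mix (hv n) (by norm_num) (by norm_num), ?_⟩
        rw [(hv m).lintegral_σ_mix (hv n)]
        have h1 : ∀ k, N ≤ k → ∫⁻ x, v k x ∂sys.σ ≤ c + ε N := fun k hk =>
          (hvA k).2.trans (add_le_add_right (hε_anti hk) _)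
        calc _ ≤ ENNReal.ofReal (1 - 1 / 2) * (c + ε N) + ENNReal.ofReal (1 / 2) * (c + ε N) :=
              add_le_add (mul_le_mul_right (h1 m hm) _) (mul_le_mul_right (h1 n hn) _)
          _ = c + ε N := by rw [← add_mul, hhalf, one_mul]
      have h2 : g N ≤ sys.negEntropy (NAThermo.mix (1 / 2) (v m) (v n)) := iInf₂_le _ hmid
      have h3 := (hv m).negEntropy_midpoint_add_le (hv n)
      refine ENNReal.le_sub_of_add_le_left ((hgM N).trans_lt hMt.lt_top).ne ?_
      calc _ ≤ _ := add_le_add_left h2 _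
        _ ≤ _ := h3
        _ ≤ ENNReal.ofReal (1 / 2) * ((G + ε N) + (G + ε N)) := by
            refine mul_le_mul_right (add_le_add ((hvG' m).trans ?_) ((hvG' n).trans ?_)) _
            · exact add_le_add_right (hε_anti hm) _
            · exact add_le_add_right (hε_anti hn) _
        _ = G + ε N := hhalf' _)
  obtain ⟨u, hu, huw, hule⟩ := exists_state_of_ae_tendsto (fun n => hv (φ n)) hae hint
  have hεφ : Tendsto (fun n => ε (φ n)) atTop (𝓝 0) := hε_lim.comp hφ.tendsto_atTop
  refine ⟨u, hu, ?_, fun z hz hzc => ?_⟩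
  · calc ∫⁻ x, u x ∂sys.σ ≤ ∫⁻ x, liminf (fun n => v (φ n) x) atTop ∂sys.σ :=
          lintegral_mono_ae (sys.ae_σ_mem.mono hule)
      _ ≤ liminf (fun n => ∫⁻ x, v (φ n) x ∂sys.σ) atTop :=
          lintegral_liminf_le' fun n => (hv (φ n)).aemeasurable_σ
      _ ≤ liminf (fun n => c + ε (φ n)) atTop :=
          liminf_le_liminf (Eventually.of_forall fun n => (hvA (φ n)).2)
      _ = c := by
          refine Tendsto.liminf_eq ?_
          simpa using tendsto_const_nhds.add hεφ
  · have hGz : G ≤ sys.negEntropy z := iSup_le fun k => iInf₂_le z ⟨hz, hzc.trans le_self_add⟩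
    refine le_trans ?_ hGz
    calc sys.negEntropy u = ∫⁻ x, liminf (fun n => mulLogAddOne (v (φ n) x)) atTop ∂sys.μ := by
          refine lintegral_congr_ae ?_
          filter_upwards [huw, hae] with x hx hx'
          rw [hx]
          exact (((tendsto_mulLogAddOne (hwt x)).comp hx').liminf_eq).symm
      _ ≤ liminf (fun n => sys.negEntropy (v (φ n))) atTop :=
          lintegral_liminf_le' fun n => (hv (φ n)).aemeasurable_mulLogAddOne
      _ ≤ liminf (fun n => G + ε (φ n)) atTop :=
          liminf_le_liminf (Eventually.of_forall fun n => hvG' (φ n))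
      _ = G := by
          refine Tendsto.liminf_eq ?_
          simpa using tendsto_const_nhds.add hεφ

end System

/-! ### Inverses of positive extended reals. -/

theorem ereal_inv_le_coe_iff {b : EReal} (hb : 0 < b) {T : ℝ} (hT : 0 < T) :
    b⁻¹ ≤ (T : EReal) ↔ ((T⁻¹ : ℝ) : EReal) ≤ b := by
  induction b using EReal.rec with
  | bot => simp at hb
  | top => simpa using hT.le
  | coe b =>
    have hb' : 0 < b := EReal.coe_pos.1 hb
    rw [← EReal.coe_inv, EReal.coe_le_coe_iff, EReal.coe_le_coe_iff, inv_le_comm₀ hb' hT]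

theorem ereal_coe_le_inv_iff {b : EReal} (hb : 0 < b) {T : ℝ} (hT : 0 < T) :
    (T : EReal) ≤ b⁻¹ ↔ b ≤ ((T⁻¹ : ℝ) : EReal) := by
  induction b using EReal.rec with
  | bot => simp at hb
  | top => simpa using hT
  | coe b =>
    have hb' : 0 < b := EReal.coe_pos.1 hb
    rw [← EReal.coe_inv, EReal.coe_le_coe_iff, EReal.coe_le_coe_iff, le_inv_comm₀ hT hb']

theorem ereal_inv_nonpos_iff {b : EReal} (hb : 0 < b) : b⁻¹ ≤ 0 ↔ b = ⊤ := by
  refine ⟨fun h => ?_, fun h => by simp [h]⟩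
  by_contra hne
  exact absurd (EReal.inv_pos_of_pos_ne_top hb hne) (not_lt.2 h)

/-! ### Concave envelopes: an affine energy and a concave entropy. -/

section AbstractEnsemble

variable {X : Type*} {e s : X → ℝ}

/-- From maximizers of the entropy at bounded energy to maximizers at fixed energy, by mixing with
the state of largest entropy. -/
theorem exists_maximizer_of_energy_eq
    (hmix : ∀ x y, ∀ t : ℝ, 0 ≤ t → t ≤ 1 →
      ∃ z, e z = (1 - t) * e x + t * e y ∧ (1 - t) * s x + t * s y ≤ s z)
    (hs : ∀ x, s x ≤ 0) {o : X} (ho : s o = 0) (hmax : ∀ x, s x = 0 → e o ≤ e x) {c : ℝ}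
    (hc : c < e o) (hx : ∃ x, e x ≤ c ∧ ∀ y, e y ≤ c → s y ≤ s x) :
    ∃ x, e x = c ∧ s x < 0 ∧ ∀ y, e y ≤ c → s y ≤ s x := by
  obtain ⟨x, hxc, hxmax⟩ := hx
  have hpos : 0 < e o - e x := by linarith
  -- The weight brings the energy exactly to `c`; the entropy does not drop, as `s o = 0` is its
  -- largest value.
  obtain ⟨z, hze, hzs⟩ := hmix x o ((c - e x) / (e o - e x))
    (div_nonneg (by linarith) hpos.le) ((div_le_one hpos).2 (by linarith))
  set t := (c - e x) / (e o - e x) with ht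
  have ht0 : 0 ≤ t := div_nonneg (by linarith) hpos.le
  have hte : t * (e o - e x) = c - e x := div_mul_cancel₀ _ hpos.ne'
  have hzc : e z = c := by rw [hze]; linarith
  have hzx : s x ≤ s z := by
    rw [ho] at hzs
    nlinarith [mul_nonneg ht0 (neg_nonneg.2 (hs x))]
  refine ⟨z, hzc, lt_of_le_of_ne (hs z) fun h0 => ?_, fun y hy => (hxmax y hy).trans hzx⟩
  linarith [hmax z h0]

/-- Equality of the canonical and the equilibrium temperatures, for an affine energy `e`, a concave
entropy `s` and its supremum `f` at fixed energy. -/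
theorem exists_derivs_of_ensemble {f : ℝ → EReal} {U : ℝ}
    (hmix : ∀ x y, ∀ t : ℝ, 0 ≤ t → t ≤ 1 →
      ∃ z, e z = (1 - t) * e x + t * e y ∧ (1 - t) * s x + t * s y ≤ s z)
    (hs : ∀ x, s x ≤ 0) {o : X} (ho : s o = 0)
    (hmaximizer : ∀ c, c < e o → (∃ x, e x ≤ c) →
      ∃ x, e x = c ∧ s x < 0 ∧ ∀ y, e y ≤ c → s y ≤ s x)
    (hf : ∀ x, (∀ y, e y = e x → s y ≤ s x) → f (e x) = s x)
    (hfbot : ∀ c, (∀ x, e x ≠ c) → f c = ⊥)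
    (hU : U < e o) (hUx : ∃ x, e x ≤ U) :
    ∃ βplus βminus : EReal, HasRightDeriv f βplus U ∧ HasLeftDeriv f βminus U ∧
      0 < βplus ∧ 0 < βminus ∧
      ∀ T : ℝ, (βminus⁻¹ ≤ (T : EReal) ∧ (T : EReal) ≤ βplus⁻¹) ↔
        0 ≤ T ∧ ∃ x, e x = U ∧ (∀ y, e x - T * s x ≤ e y - T * s y) ∧
          (T = 0 → ∀ y, e y = U → s y ≤ s x) := by
  obtain ⟨xU, hxU, hsU, hxUmax⟩ := hmaximizer U hU hUx
  set φ : ℝ → EReal := fun y => (f y - f U) / ((y - U : ℝ) : EReal) with hφ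
  have hfU : f U = s xU := by
    rw [← hxU]
    exact hf xU fun y hy => hxUmax y (by rw [hy, hxU])
  have hval : ∀ x, (∀ y, e y = e x → s y ≤ s x) →
      φ (e x) = (((s x - s xU) / (e x - U) : ℝ) : EReal) := by
    intro x hx
    simp only [hφ]
    rw [hf x hx, hfU, ← EReal.coe_sub, ← EReal.coe_div]
  -- Slope of the chord from `(U, s xU)` to `(e o, 0)`; by concavity it bounds the quotients `φ y`,
  -- `y < e o`, from below.
  set κ : ℝ := -s xU / (e o - U) with hκ
  have hκ0 : 0 < κ := div_pos (by linarith) (by linarith)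
  -- Below all attained energies the quotient is `⊥` divided by a negative number, hence `⊤`: this
  -- makes the left derivative infinite at the least energy.
  have htop : ∀ y, y < U → (∀ x, ¬ e x ≤ y) → φ y = ⊤ := by
    intro y hy hn
    simp only [hφ]
    rw [hfbot y fun x hx => hn x hx.le, hfU, EReal.bot_sub]
    exact EReal.bot_div_of_neg_ne_bot (EReal.coe_neg'.2 (by linarith)) (EReal.coe_ne_bot _)
  -- the slopes above `U`
  have hright : ∀ y, U < y → y < e o → ∃ x, e x = y ∧ (∀ z, e z ≤ y → s z ≤ s x) ∧
      φ y = (((s x - s xU) / (y - U) : ℝ) : EReal) := by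
    intro y hy hy1
    obtain ⟨x, hx, -, hxm⟩ := hmaximizer y hy1 ⟨xU, by linarith⟩
    refine ⟨x, hx, hxm, ?_⟩
    rw [← hx]
    exact hval x fun z hz => hxm z (by rw [hz, hx])
  have hleft : ∀ y, y < U → (∃ x, e x ≤ y) → ∃ x, e x = y ∧ (∀ z, e z ≤ y → s z ≤ s x) ∧
      φ y = (((s x - s xU) / (y - U) : ℝ) : EReal) := by
    intro y hy hy1
    obtain ⟨x, hx, -, hxm⟩ := hmaximizer y (by linarith) hy1
    refine ⟨x, hx, hxm, ?_⟩
    rw [← hx]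
    exact hval x fun z hz => hxm z (by rw [hz, hx])
  -- concavity between three energies
  have hconc : ∀ x y : X, ∀ c m : ℝ, e x < c → c < e y → (∀ z, e z = c → s z ≤ m) →
      (e y - c) * s x + (c - e x) * s y ≤ (e y - e x) * m := by
    intro x y c m hxc hcy hm
    have hpos : 0 < e y - e x := by linarith
    obtain ⟨z, hze, hzs⟩ := hmix x y ((c - e x) / (e y - e x))
      (div_nonneg (by linarith) hpos.le) ((div_le_one hpos).2 (by linarith))
    set t := (c - e x) / (e y - e x) with ht
    have hte : t * (e y - e x) = c - e x := div_mul_cancel₀ _ hpos.ne'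
    have hzc : e z = c := by rw [hze]; linarith
    have h1 := mul_le_mul_of_nonneg_left (hzs.trans (hm z hzc)) hpos.le
    have h2 : (e y - e x) * ((1 - t) * s x + t * s y) =
        (e y - e x - t * (e y - e x)) * s x + t * (e y - e x) * s y := by ring
    rw [h2, hte] at h1
    linarith
  have hantiR : AntitoneOn φ (Ioo U (e o)) := by
    intro y hy y' hy' hyy
    rcases hyy.eq_or_lt with rfl | hlt
    · exact le_rfl
    obtain ⟨x, hx, hxm, hxv⟩ := hright y hy.1 hy.2
    obtain ⟨x', hx', -, hxv'⟩ := hright y' hy'.1 hy'.2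
    rw [hxv, hxv', EReal.coe_le_coe_iff, div_le_div_iff₀ (by linarith [hy'.1]) (by linarith [hy.1])]
    have := hconc xU x' y (s x) (by rw [hxU]; exact hy.1) (by rw [hx']; exact hlt)
      fun z hz => hxm z hz.le
    rw [hx', hxU] at this
    linarith
  have hantiL : AntitoneOn φ (Iio U) := by
    intro y hy y' hy' hyy
    rcases hyy.eq_or_lt with rfl | hlt
    · exact le_rfl
    have hyU : y < U := hy
    have hyU' : y' < U := hy'
    by_cases hex : ∃ x, e x ≤ y
    · obtain ⟨x, hx, -, hxv⟩ := hleft y hyU hex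
      obtain ⟨x', hx', hxm, hxv'⟩ := hleft y' hyU' ⟨x, by linarith⟩
      rw [hxv, hxv', EReal.coe_le_coe_iff, ← neg_div_neg_eq, ← neg_div_neg_eq (s x - s xU),
        div_le_div_iff₀ (by linarith) (by linarith)]
      have := hconc x xU y' (s x') (by rw [hx]; exact hlt) (by rw [hxU]; exact hyU')
        fun z hz => hxm z hz.le
      rw [hx, hxU] at this
      linarith
    · push Not at hex
      rw [htop y hyU fun x => not_le.2 (hex x)]
      exact le_top
  have hκR : ∀ y, U < y → y < e o → (κ : EReal) ≤ φ y := by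
    intro y hy hy1
    obtain ⟨x, hx, hxm, hxv⟩ := hright y hy hy1
    rw [hxv, EReal.coe_le_coe_iff, hκ, div_le_div_iff₀ (by linarith) (by linarith)]
    have := hconc xU o y (s x) (by rw [hxU]; exact hy) hy1 fun z hz => hxm z hz.le
    rw [hxU, ho] at this
    linarith
  have hκL : ∀ y, y < U → (κ : EReal) ≤ φ y := by
    intro y hy
    by_cases hex : ∃ x, e x ≤ y
    · obtain ⟨x, hx, -, hxv⟩ := hleft y hy hex
      rw [hxv, EReal.coe_le_coe_iff, hκ, ← neg_div_neg_eq (s x - s xU),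
        div_le_div_iff₀ (by linarith) (by linarith)]
      have := hconc x o U (s xU) (by rw [hx]; exact hy) hU fun z hz => hxUmax z hz.le
      rw [hx, ho] at this
      linarith
    · push Not at hex
      rw [htop y hy fun x => not_le.2 (hex x)]
      exact le_top
  -- The quotients decrease in `y` on either side of `U`, so their limits at `U` are a supremum from
  -- the right and an infimum from the left.
  set βp : EReal := sSup (φ '' Ioo U (e o)) with hβp
  set βm : EReal := sInf (φ '' Iio U) with hβm
  have hmid : (U + e o) / 2 ∈ Ioo U (e o) := ⟨by linarith, by linarith⟩
  have hκp : (κ : EReal) ≤ βp :=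
    (hκR _ hmid.1 hmid.2).trans (le_sSup (mem_image_of_mem φ hmid))
  have hκm : (κ : EReal) ≤ βm := by
    refine le_sInf ?_
    rintro _ ⟨y, hy, rfl⟩
    exact hκL y hy
  have hβp0 : 0 < βp := (EReal.coe_pos.2 hκ0).trans_le hκp
  have hβm0 : 0 < βm := (EReal.coe_pos.2 hκ0).trans_le hκm
  refine ⟨βp, βm, hantiR.tendsto_nhdsWithin_Ioo_right ⟨_, hmid⟩ (OrderTop.bddAbove _),
    hantiL.tendsto_nhdsLT (OrderBot.bddBelow _), hβp0, hβm0, fun T => ?_⟩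
  rcases lt_trichotomy T 0 with hT | rfl | hT
  · refine iff_of_false (fun h => ?_) fun h => not_le.2 hT h.1
    exact absurd ((EReal.inv_nonneg_of_nonneg hβm0.le).trans h.1) (not_le.2 (EReal.coe_neg'.2 hT))
  -- At `T = 0` both sides say that `U` is the least energy, since any smaller energy produces a
  -- finite quotient on the left.
  · rw [EReal.coe_zero, ereal_inv_nonpos_iff hβm0,
      and_iff_left (EReal.inv_nonneg_of_nonneg hβp0.le)]
    simp only [le_refl, zero_mul, sub_zero, true_and, forall_true_left]
    constructor
    · intro h
      refine ⟨xU, hxU, fun y => ?_, fun y hy => hxUmax y hy.le⟩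
      by_contra! hlt
      rw [hxU] at hlt
      obtain ⟨x, -, -, hxv⟩ := hleft (e y) hlt ⟨y, le_rfl⟩
      have h1 : βm ≤ φ (e y) := sInf_le (mem_image_of_mem φ hlt)
      rw [h, hxv] at h1
      exact absurd h1 (not_le.2 (EReal.coe_lt_top _))
    · rintro ⟨x, hx, hmin, -⟩
      refine sInf_eq_top.2 ?_
      rintro _ ⟨y, hy, rfl⟩
      refine htop y hy fun z hz => ?_
      have hy' : y < U := hy
      linarith [hmin z]
  · rw [ereal_inv_le_coe_iff hβm0 hT, ereal_coe_le_inv_iff hβp0 hT]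
    have hTi : T * T⁻¹ = 1 := mul_inv_cancel₀ hT.ne'
    have hTi0 : 0 < T⁻¹ := inv_pos.2 hT
    constructor
    · rintro ⟨hm, hp⟩
      refine ⟨hT.le, xU, hxU, fun y => ?_, fun h => absurd h hT.ne'⟩
      -- The line of slope `T⁻¹` supports the envelope. From the energy `e o` on, no quotient is
      -- available and `s y ≤ 0` with `κ ≤ T⁻¹` is used instead.
      have key : s y - s xU ≤ T⁻¹ * (e y - U) := by
        rcases lt_trichotomy (e y) U with hlt | heq | hgt
        · obtain ⟨x, -, hxm, hxv⟩ := hleft (e y) hlt ⟨y, le_rfl⟩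
          have h1 := hm.trans (sInf_le (mem_image_of_mem φ hlt))
          rw [hxv, EReal.coe_le_coe_iff, le_div_iff_of_neg (by linarith)] at h1
          linarith [hxm y le_rfl]
        · rw [heq, sub_self, mul_zero]
          linarith [hxUmax y heq.le]
        · rcases lt_or_ge (e y) (e o) with hlt | hge
          · obtain ⟨x, -, hxm, hxv⟩ := hright (e y) hgt hlt
            have h1 := (le_sSup (mem_image_of_mem φ
              (show e y ∈ Ioo U (e o) from ⟨hgt, hlt⟩))).trans hp
            rw [hxv, EReal.coe_le_coe_iff, div_le_iff₀ (by linarith)] at h1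
            linarith [hxm y le_rfl]
          · have h1 := hκp.trans hp
            rw [EReal.coe_le_coe_iff, hκ, div_le_iff₀ (by linarith)] at h1
            have h2 := mul_le_mul_of_nonneg_left (by linarith : e o - U ≤ e y - U) hTi0.le
            linarith [hs y]
      have h2 := mul_le_mul_of_nonneg_left key hT.le
      rw [← mul_assoc, hTi, one_mul] at h2
      rw [hxU]
      linarith
    · rintro ⟨-, x, hx, hmin, -⟩
      have hsx : s xU ≤ s x := by
        have := hmin xU
        rw [hx, hxU] at this
        exact le_of_mul_le_mul_left (by linarith) hT
      have hsx' : s x ≤ s xU := hxUmax x hx.le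
      have key : ∀ y, s y - s xU ≤ T⁻¹ * (e y - U) := by
        intro y
        have h1 := hmin y
        rw [hx, le_antisymm hsx' hsx] at h1
        have h2 : T * (s y - s xU) ≤ T * (T⁻¹ * (e y - U)) := by
          rw [← mul_assoc, hTi, one_mul]; linarith
        exact le_of_mul_le_mul_left h2 hT
      constructor
      · refine le_sInf ?_
        rintro _ ⟨y, hy, rfl⟩
        have hy' : y < U := hy
        by_cases hex : ∃ z, e z ≤ y
        · obtain ⟨z, hz, -, hzv⟩ := hleft y hy' hex
          rw [hzv, EReal.coe_le_coe_iff, le_div_iff_of_neg (by linarith)]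
          have := key z
          rwa [hz] at this
        · push Not at hex
          rw [htop y hy' fun z => not_le.2 (hex z)]
          exact le_top
      · refine sSup_le ?_
        rintro _ ⟨y, hy, rfl⟩
        obtain ⟨z, hz, -, hzv⟩ := hright y hy.1 hy.2
        rw [hzv, EReal.coe_le_coe_iff, div_le_iff₀ (by linarith [hy.1])]
        have := key z
        rwa [hz] at this

end AbstractEnsemble

/-! ### States of finite energy as an ensemble. -/

namespace System

variable {V : Type*} [NormedAddCommGroup V] [NormedSpace ℝ V]
  [MeasurableSpace V] (sys : System V)

/-- The states of finite energy. -/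
abbrev FiniteState : Type _ := {u : V → ℝ≥0∞ // sys.IsState u ∧ ∫⁻ x, u x ∂sys.σ ≠ ∞}

variable {sys}

/-- The energy of a state of finite energy, as a real number. -/
noncomputable def FiniteState.energy (u : sys.FiniteState) : ℝ :=
  (∫⁻ x, u.1 x ∂sys.σ).toReal / (sys.μ univ).toReal

/-- The entropy of a state of finite energy, as a real number. -/
noncomputable def FiniteState.entropy (u : sys.FiniteState) : ℝ :=
  1 - (sys.negEntropy u.1).toReal / (sys.μ univ).toReal

theorem μ_univ_toReal_pos (sys : System V) : 0 < (sys.μ univ).toReal :=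
  ENNReal.toReal_pos sys.μ_univ_ne_zero sys.μ_univ_ne_top

theorem FiniteState.coe_energy (u : sys.FiniteState) :
    (u.energy : EReal) = sys.energy u.1 := by
  rw [System.energy, energy, ← ENNReal.toReal_div]
  have h : (∫⁻ x, u.1 x ∂sys.σ) / sys.μ univ ≠ ∞ :=
    ENNReal.div_ne_top u.2.2 sys.μ_univ_ne_zero
  exact EReal.coe_ennreal_toReal h

theorem lintegral_σ_ne_top_of_energy {u : V → ℝ≥0∞} {c : ℝ} (h : sys.energy u = c) :
    ∫⁻ x, u x ∂sys.σ ≠ ∞ := by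
  intro htop
  rw [energy, htop, ENNReal.top_div_of_ne_top sys.μ_univ_ne_top, EReal.coe_ennreal_top] at h
  exact EReal.coe_ne_top c h.symm

variable [BorelSpace V] [FiniteDimensional ℝ V]

theorem FiniteState.negEntropy_ne_top [Nontrivial V] (u : sys.FiniteState) :
    sys.negEntropy u.1 ≠ ∞ := by
  obtain ⟨C, hC, h⟩ := exists_negEntropy_le sys
  exact ((h u.1 u.2.1).trans_lt (ENNReal.mul_lt_top hC.lt_top
    (ENNReal.add_lt_top.2 ⟨sys.σ_univ_lt_top, u.2.2.lt_top⟩))).ne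

theorem FiniteState.coe_entropy [Nontrivial V] (u : sys.FiniteState) :
    (u.entropy : EReal) = sys.entropy u.1 := by
  have h : sys.negEntropy u.1 / sys.μ univ ≠ ∞ :=
    ENNReal.div_ne_top u.negEntropy_ne_top sys.μ_univ_ne_zero
  rw [u.2.1.entropy_eq, entropy, ← ENNReal.toReal_div, EReal.coe_sub, EReal.coe_one,
    EReal.coe_ennreal_toReal h]

theorem FiniteState.freeEnergy_eq [Nontrivial V] (u : sys.FiniteState) (T : ℝ) :
    sys.freeEnergy T u.1 = ((u.energy - T * u.entropy : ℝ) : EReal) := by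
  rw [freeEnergy, if_neg (by rw [← u.coe_entropy]; exact EReal.coe_ne_bot _), ← u.coe_entropy,
    ← u.coe_energy, EReal.coe_sub, EReal.coe_mul]

omit [BorelSpace V] [FiniteDimensional ℝ V] in
-- The entropy is never `⊤`, so outside the case `⊥` a real number is subtracted from `⊤`.
theorem freeEnergy_eq_top {u : V → ℝ≥0∞}
    (h : ∫⁻ x, u x ∂sys.σ = ∞) (T : ℝ) : sys.freeEnergy T u = ⊤ := by
  unfold freeEnergy
  split_ifs with hs
  · rfl
  · have h1 : sys.entropy u ≠ ⊤ := by
      unfold System.entropy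
      split_ifs
      · exact EReal.coe_ne_top _
      · exact bot_ne_top
    lift sys.entropy u to ℝ using ⟨h1, hs⟩ with r
    rw [energy, h, ENNReal.top_div_of_ne_top sys.μ_univ_ne_top, EReal.coe_ennreal_top,
      ← EReal.coe_mul, EReal.top_sub_coe]

theorem FiniteState.exists_mix [Nontrivial V] (u v : sys.FiniteState) (t : ℝ) (h0 : 0 ≤ t)
    (h1 : t ≤ 1) :
    ∃ w : sys.FiniteState, w.energy = (1 - t) * u.energy + t * v.energy ∧
      (1 - t) * u.entropy + t * v.entropy ≤ w.entropy := by
  have hm := sys.μ_univ_toReal_pos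
  have h1' : 0 ≤ 1 - t := by linarith
  have hE := u.2.1.lintegral_σ_mix v.2.1 t
  have hG := u.2.1.negEntropy_mix_le v.2.1 h0 h1
  have ht : ∀ (r : ℝ) {a : ℝ≥0∞}, a ≠ ∞ → ENNReal.ofReal r * a ≠ ∞ := fun r a ha =>
    ENNReal.mul_ne_top ENNReal.ofReal_ne_top ha
  refine ⟨⟨NAThermo.mix t u.1 v.1, u.2.1.mix v.2.1 h0 h1, ?_⟩, ?_, ?_⟩
  · rw [hE]
    exact ENNReal.add_ne_top.2 ⟨ht _ u.2.2, ht _ v.2.2⟩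
  · unfold FiniteState.energy
    rw [hE, ENNReal.toReal_add (ht _ u.2.2) (ht _ v.2.2), ENNReal.toReal_mul, ENNReal.toReal_mul,
      ENNReal.toReal_ofReal h1', ENNReal.toReal_ofReal h0]
    ring
  · have hG' := ENNReal.toReal_mono (ENNReal.add_ne_top.2
      ⟨ht (1 - t) u.negEntropy_ne_top, ht t v.negEntropy_ne_top⟩) hG
    rw [ENNReal.toReal_add (ht _ u.negEntropy_ne_top) (ht _ v.negEntropy_ne_top),
      ENNReal.toReal_mul, ENNReal.toReal_mul, ENNReal.toReal_ofReal h1',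
      ENNReal.toReal_ofReal h0] at hG'
    unfold FiniteState.entropy
    have h2 := div_le_div_of_nonneg_right hG' hm.le
    rw [add_div, mul_div_assoc, mul_div_assoc] at h2
    simp only
    linarith

theorem FiniteState.entropy_nonpos [Nontrivial V] (u : sys.FiniteState) : u.entropy ≤ 0 := by
  have h := ENNReal.toReal_mono u.negEntropy_ne_top u.2.1.le_negEntropy
  have := (one_le_div sys.μ_univ_toReal_pos).2 h
  unfold FiniteState.entropy
  linarith

/-- The constant state. -/
noncomputable def FiniteState.one (sys : System V) : sys.FiniteState :=
  ⟨fun _ => 1, isState_one, by simp [sys.σ_univ_lt_top.ne]⟩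

theorem FiniteState.entropy_one : (FiniteState.one sys).entropy = 0 := by
  change 1 - (sys.negEntropy fun _ => 1).toReal / _ = 0
  rw [negEntropy_one, div_self sys.μ_univ_toReal_pos.ne', sub_self]

theorem FiniteState.energy_one_le [Nontrivial V] (u : sys.FiniteState) (hu : u.entropy = 0) :
    (FiniteState.one sys).energy ≤ u.energy := by
  have hm := sys.μ_univ_toReal_pos
  have h1 : (sys.negEntropy u.1).toReal = (sys.μ univ).toReal := by
    unfold FiniteState.entropy at hu
    field_simp at hu
    linarith
  have h2 : sys.negEntropy u.1 ≤ sys.μ univ :=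
    ((ENNReal.toReal_eq_toReal_iff' u.negEntropy_ne_top sys.μ_univ_ne_top).1 h1).le
  have h3 := ENNReal.toReal_mono u.2.2 (u.2.1.lintegral_σ_one_le h2)
  refine div_le_div_of_nonneg_right ?_ hm.le
  simpa [FiniteState.one] using h3

theorem FiniteState.exists_max_entropy [Nontrivial V] {c : ℝ} (hc : 0 ≤ c)
    (hinf : ⨅ (u : V → ℝ≥0∞) (_ : sys.IsState u), ∫⁻ x, u x ∂sys.σ ≤
      ENNReal.ofReal (c * (sys.μ univ).toReal)) :
    ∃ u : sys.FiniteState, u.energy ≤ c ∧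
      ∀ v : sys.FiniteState, v.energy ≤ c → v.entropy ≤ u.entropy := by
  have hm := sys.μ_univ_toReal_pos
  obtain ⟨u, hu, huc, hmax⟩ := System.exists_max_entropy ENNReal.ofReal_ne_top hinf
  have hcm : 0 ≤ c * (sys.μ univ).toReal := by positivity
  refine ⟨⟨u, hu, (huc.trans_lt ENNReal.ofReal_lt_top).ne⟩, ?_, fun v hv => ?_⟩
  · unfold FiniteState.energy
    rw [div_le_iff₀ hm]
    have := ENNReal.toReal_mono ENNReal.ofReal_ne_top huc
    rwa [ENNReal.toReal_ofReal hcm] at this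
  · unfold FiniteState.energy at hv
    rw [div_le_iff₀ hm] at hv
    have h1 : ∫⁻ x, v.1 x ∂sys.σ ≤ ENNReal.ofReal (c * (sys.μ univ).toReal) := by
      rw [← ENNReal.ofReal_toReal v.2.2]
      exact ENNReal.ofReal_le_ofReal hv
    have h2 := ENNReal.toReal_mono v.negEntropy_ne_top (hmax v.1 v.2.1 h1)
    unfold FiniteState.entropy
    have := div_le_div_of_nonneg_right h2 hm.le
    simp only
    linarith

omit [BorelSpace V] [FiniteDimensional ℝ V] in
theorem FiniteState.energy_nonneg (u : sys.FiniteState) : 0 ≤ u.energy := by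
  unfold FiniteState.energy; positivity

theorem FiniteState.exists_maximizer [Nontrivial V] {c : ℝ}
    (hc : c < (FiniteState.one sys).energy) (hx : ∃ u : sys.FiniteState, u.energy ≤ c) :
    ∃ u : sys.FiniteState, u.energy = c ∧ u.entropy < 0 ∧
      ∀ v : sys.FiniteState, v.energy ≤ c → v.entropy ≤ u.entropy := by
  have hm := sys.μ_univ_toReal_pos
  obtain ⟨v, hv⟩ := hx
  refine exists_maximizer_of_energy_eq FiniteState.exists_mix FiniteState.entropy_nonpos
    FiniteState.entropy_one FiniteState.energy_one_le hc
    (FiniteState.exists_max_entropy (v.energy_nonneg.trans hv) ((iInf₂_le v.1 v.2.1).trans ?_))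
  unfold FiniteState.energy at hv
  rw [div_le_iff₀ hm] at hv
  rw [← ENNReal.ofReal_toReal v.2.2]
  exact ENNReal.ofReal_le_ofReal hv

theorem eqEntropy_eq [Nontrivial V] (u : sys.FiniteState)
    (hu : ∀ v : sys.FiniteState, v.energy = u.energy → v.entropy ≤ u.entropy) :
    sys.eqEntropy u.energy = u.entropy := by
  refine le_antisymm (iSup₂_le fun v hv => ?_) ?_
  · have h1 := lintegral_σ_ne_top_of_energy hv.2
    set w : sys.FiniteState := ⟨v, hv.1, h1⟩ with hw
    have h2 : w.energy = u.energy := by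
      have := w.coe_energy.trans hv.2
      exact_mod_cast this
    rw [← w.coe_entropy]
    exact_mod_cast hu w h2
  · rw [u.coe_entropy]
    exact le_iSup₂_of_le u.1 ⟨u.2.1, u.coe_energy.symm⟩ le_rfl

omit [BorelSpace V] [FiniteDimensional ℝ V] in
theorem eqEntropy_eq_bot {c : ℝ} (hc : ∀ u : sys.FiniteState, u.energy ≠ c) :
    sys.eqEntropy c = ⊥ := by
  refine le_bot_iff.1 (iSup₂_le fun v hv => ?_)
  set w : sys.FiniteState := ⟨v, hv.1, lintegral_σ_ne_top_of_energy hv.2⟩ with hw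
  refine absurd ?_ (hc w)
  have := w.coe_energy.trans hv.2
  exact_mod_cast this

/-- Infinite energy means infinite free energy, and finite energy forces finite entropy, so
real-valued quantities suffice. At `T = 0` all minimizers share the energy `U`, which turns the
tie-break into maximality of the entropy at that energy. -/
theorem mem_canTemp_iff [Nontrivial V] {U T : ℝ} :
    T ∈ sys.canTemp U ↔ 0 ≤ T ∧ ∃ u : sys.FiniteState, u.energy = U ∧
      (∀ v : sys.FiniteState, u.energy - T * u.entropy ≤ v.energy - T * v.entropy) ∧
        (T = 0 → ∀ v : sys.FiniteState, v.energy = U → v.entropy ≤ u.entropy) := by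
  refine and_congr_right fun hT => ⟨?_, ?_⟩
  · rintro ⟨u, ⟨⟨hu, hmin⟩, hzero⟩, hU⟩
    set w : sys.FiniteState := ⟨u, hu, lintegral_σ_ne_top_of_energy hU⟩ with hw
    have hwU : w.energy = U := by
      have := w.coe_energy.trans hU
      exact_mod_cast this
    refine ⟨w, hwU, fun v => ?_, fun hT0 v hv => ?_⟩
    · have := hmin v.1 v.2.1
      rw [w.freeEnergy_eq, v.freeEnergy_eq] at this
      exact_mod_cast this
    · subst hT0
      have hvmin : sys.IsMinimizer 0 v.1 := by
        refine ⟨v.2.1, fun z hz => le_trans (le_of_eq ?_) (hmin z hz)⟩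
        rw [v.freeEnergy_eq, w.freeEnergy_eq, hv, hwU, zero_mul, zero_mul]
      have := hzero rfl v.1 hvmin
      rw [← v.coe_entropy, ← w.coe_entropy] at this
      exact_mod_cast this
  · rintro ⟨u, hU, hmin, hzero⟩
    refine ⟨u.1, ⟨⟨u.2.1, fun v hv => ?_⟩, fun hT0 v hv => ?_⟩, ?_⟩
    · by_cases htop : ∫⁻ x, v x ∂sys.σ = ∞
      · rw [freeEnergy_eq_top htop]
        exact le_top
      · set w : sys.FiniteState := ⟨v, hv, htop⟩ with hw
        rw [u.freeEnergy_eq, w.freeEnergy_eq]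
        exact_mod_cast hmin w
    · subst hT0
      have hle := hv.2 u.1 u.2.1
      by_cases htop : ∫⁻ x, v x ∂sys.σ = ∞
      · rw [freeEnergy_eq_top htop, u.freeEnergy_eq] at hle
        exact absurd hle (not_le.2 (EReal.coe_lt_top _))
      · set w : sys.FiniteState := ⟨v, hv.1, htop⟩ with hw
        rw [u.freeEnergy_eq, w.freeEnergy_eq, EReal.coe_le_coe_iff] at hle
        have h1 := hmin w
        have h2 : w.energy = U := by linarith
        rw [← u.coe_entropy, ← w.coe_entropy]
        exact_mod_cast hzero rfl w h2
    · rw [← u.coe_energy, hU]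

omit [BorelSpace V] [FiniteDimensional ℝ V] in
theorem nonneg_of_mem_energyRange {U : ℝ} (hU : U ∈ sys.energyRange) : 0 ≤ U := by
  have h1 : (0 : EReal) ≤ ⨅ (u : V → ℝ≥0∞) (_ : sys.IsState u), sys.energy u :=
    le_iInf₂ fun u _ => EReal.coe_ennreal_nonneg _
  exact_mod_cast h1.trans hU.1

omit [BorelSpace V] [FiniteDimensional ℝ V] in
theorem iInf_lintegral_σ_le {U : ℝ} (hU : U ∈ sys.energyRange) :
    ⨅ (u : V → ℝ≥0∞) (_ : sys.IsState u), ∫⁻ x, u x ∂sys.σ ≤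
      ENNReal.ofReal (U * (sys.μ univ).toReal) := by
  have hm0 := sys.μ_univ_ne_zero
  have hmt := sys.μ_univ_ne_top
  have hU0 := nonneg_of_mem_energyRange hU
  refine le_of_forall_gt fun b hb => ?_
  rw [ENNReal.ofReal_mul hU0, ENNReal.ofReal_toReal hmt,
    ← ENNReal.lt_div_iff_mul_lt (Or.inl hm0) (Or.inl hmt)] at hb
  have h1 : (U : EReal) < ((b / sys.μ univ : ℝ≥0∞) : EReal) := by
    rw [← max_eq_left hU0, ← EReal.coe_ennreal_ofReal]
    exact EReal.coe_ennreal_lt_coe_ennreal_iff.2 hb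
  have h2 := hU.1.trans_lt h1
  simp only [iInf_lt_iff] at h2 ⊢
  obtain ⟨u, hu, hlt⟩ := h2
  refine ⟨u, hu, ?_⟩
  rw [energy, EReal.coe_ennreal_lt_coe_ennreal_iff] at hlt
  exact lt_of_not_ge fun hge => not_lt.2 (ENNReal.div_le_div_right hge _) hlt

omit [BorelSpace V] [FiniteDimensional ℝ V] in
-- In dimension zero the boundary is empty and all energies vanish, which leaves no `U` with `0 ≤ U
-- < 0`.
theorem nontrivial_of_mem_energyRange {U : ℝ} (hU : U ∈ sys.energyRange) : Nontrivial V := by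
  by_contra hV
  rw [not_nontrivial_iff_subsingleton] at hV
  have h1 := hU.2
  have h2 : sys.energy (fun _ => 1) = 0 := by
    simp [energy, sys.σ_univ_eq_zero_of_subsingleton]
  rw [h2] at h1
  exact absurd (nonneg_of_mem_energyRange hU) (not_le.2 (by exact_mod_cast h1))

end System

end NAThermo

/-- For `U ∈ 𝔘*` the one-sided derivatives `β⁺, β⁻` of the equilibrium entropy at `U` exist in
`(0, ∞]`, and `𝕋^can(U) = [1 / β⁻, 1 / β⁺]`, where `1 / ∞ = 0`. -/
theorem mainTheorem9 {V : Type*} [NormedAddCommGroup V] [NormedSpace ℝ V]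
    [FiniteDimensional ℝ V] [MeasurableSpace V] [BorelSpace V]
    (sys : NAThermo.System V) (hK : sys.IsKUnstable) (U : ℝ) (hU : U ∈ sys.energyRange) :
    ∃ βplus βminus : EReal,
      NAThermo.HasRightDeriv sys.eqEntropy βplus U ∧
      NAThermo.HasLeftDeriv sys.eqEntropy βminus U ∧
      0 < βplus ∧ 0 < βminus ∧
      sys.canTemp U = {T : ℝ | βminus⁻¹ ≤ (T : EReal) ∧ (T : EReal) ≤ βplus⁻¹} := by
  have := NAThermo.System.nontrivial_of_mem_energyRange hU
  -- The range only bounds an infimum by `U`; compactness supplies an actual state of energy at most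
  -- `U`.
  obtain ⟨u, hu, -⟩ := NAThermo.System.FiniteState.exists_max_entropy
    (NAThermo.System.nonneg_of_mem_energyRange hU) (NAThermo.System.iInf_lintegral_σ_le hU)
  have hlt : U < (NAThermo.System.FiniteState.one sys).energy := by
    have h := hU.2.trans_eq (NAThermo.System.FiniteState.one sys).coe_energy.symm
    exact_mod_cast h
  obtain ⟨βp, βm, hp, hm, hp0, hm0, hT⟩ := NAThermo.exists_derivs_of_ensemble
    NAThermo.System.FiniteState.exists_mix NAThermo.System.FiniteState.entropy_nonpos
    NAThermo.System.FiniteState.entropy_one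
    (fun c hc hx => NAThermo.System.FiniteState.exists_maximizer hc hx)
    NAThermo.System.eqEntropy_eq (fun c hc => NAThermo.System.eqEntropy_eq_bot hc) hlt ⟨u, hu⟩
  refine ⟨βp, βm, hp, hm, hp0, hm0, ?_⟩
  ext T
  rw [NAThermo.System.mem_canTemp_iff]
  exact (hT T).symm
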